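/- **Notation.** For $\alpha\in\mathbb C$ with $-\pi<\arg\alpha<\pi$ let $$S(\alpha)=-\frac1{8\pi^2}\lim_{X\to\infty}\int_0^X\frac{e^{-is}}{s^3}\Big\{2\sqrt{\pi\alpha}\,s\,\coth(2\sqrt{\pi\alpha}\,s)-1-\frac{4\pi\alpha s^2}{3}\Big\}\,ds ,$$ and for $\mathrm{Re}\,\beta>0$ let $\Phi(\beta)=S(\beta^2)$ and $\overline\Phi(\overline\beta):=\overline{\Phi(\overline\beta)}$. For $n\ge2$ let $$a_n=\frac{1}{8\pi^2}(-16\pi)^nB_{2n}\frac{(2n-3)!}{(2n)!}$$ with $B_{2n}$ the Bernoulli numbers, and let $$B(t)=\frac{2\sqrt\pi\,t\cot(2\sqrt\pi\,t)-1+4\pi t^2/3}{8\pi^2t^3},\qquad B(0)=0 .$$ *Boundary values.* For a function $G$ on the part of the open upper half-plane near $[0,\infty)$, the distribution $G(t+i0)$, $t\ge0$, is the distribution $T$ on $\mathbb R$, supported in $[0,\infty)$, with $\langle T,\varphi\rangle=\lim_{\varepsilon\to0+}\int_0^\infty G(t+i\varepsilon)\varphi(t)\,dt$ for all $\varphi\in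 C_c^\infty(\mathbb R)$, if such a $T$ exists; and $PP(G(t))=\frac12\{G(t+i0)+\overline{G(t+i0)}\}$. For a distribution $T$ supported in $[0,\infty)$, $\int_0^\infty T(t)e^{-t/z}dt$ is said to converge to $L$ if $\langle T,\chi_ke^{-t/z}\rangle\to L$ for every sequence $\chi_k\in C_c^\infty(\mathbb R)$ that is bounded uniformly in $k$ together with each derivative and is eventually equal to $1$ on every bounded interval. *Distributional Borel summability.* Let $C_R=\{z:\mathrm{Re}\,z^{-1}>R^{-1}\}$. Let $\sum_n c_nz^n$ be a formal power series whose Borel transform $\sum_n c_nt^n/n!$ has a positive radius of convergence and has an analytic continuation $G$ to the intersection of a neighbourhood of $[0,\infty)$ with the open upper half-plane, such that $G(t+i0)$, $t\ge0$, exists. If $z^{-1}\int_0^\infty PP(G(t))e^{-t/z}dt$ converges to $f(z)$ for all $z\in C_R$, the series is *Borel summable in the distributional sense* to $f$ on $C_R$; if $z^{-1}\int_0^\infty G(t+i0)e^{-t/z}dt$ converges to $\Psi(z)$ for all $z\in C_R$, $\Psi$ is the *upper sum* of the series on $C_R$. **Statement.** The limit defining $\Phi(\beta)$ exists for $\mathrm{Re}\,\beta>0$,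 and for $0<\arg\beta<\pi/2$ $$\Phi(\beta)=\frac1{8\pi^2}\int_0^\infty\frac{e^{-t}}{t^3}\Big[2\sqrt\pi\,\beta t\cot(2\sqrt\pi\,\beta t)-1+\frac{4\pi\beta^2t^2}{3}\Big]dt ,$$ the integral being absolutely convergent. The function $B$ is the Borel transform of $\sum_{n\ge2}a_n\beta^{2n-3}$, continued analytically. The boundary value distributions $B(t+i0)$ and $PP(B(t))$, $t\ge0$, exist, the latter being also the boundary value of $\mathrm{Re}\,B$. The integrals $$F(\beta)=\frac1\beta\int_0^\infty B(t+i0)e^{-t/\beta}\,dt,\qquad f(\beta)=\frac1\beta\int_0^\infty PP(B(t))e^{-t/\beta}\,dt$$ converge for all $\beta$ with $\mathrm{Re}\,\beta>0$; $F$ is analytic there, and for all such $\beta$ (in particular for $0<\arg\beta<\pi/2$) $$F(\beta)=\beta^{-3}\Phi(\beta),\qquad f(\beta)=\tfrac12\big\{\beta^{-3}\Phi(\beta)+\overline{\overline\beta^{\,-3}\,\Phi(\overline\beta)}\big\}.$$ Equivalently, for every $R>0$ the series $\sum_{n\ge2}a_n\beta^{2n-3}$ is Borel summable in the distributional sense on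 $C_R$ to $f$, with upper sum $\beta^{-3}\Phi(\beta)$. Moreover, for every $R>0$ the series $\sum_{n\ge2}a_n\beta^{2n}$ is Borel summable in the distributional sense on $C_R$ to $\beta^3f(\beta)$, with upper sum $\Phi(\beta)$, and $\beta^3f(\beta)=\frac12\{\Phi(\beta)+\overline\Phi(\overline\beta)\}$ for all $\beta$ with $\mathrm{Re}\,\beta>0$. -/

import Mathlib

open Filter Topology Complex MeasureTheory TopologicalSpace
open scoped Distributions ContDiff ComplexConjugate

noncomputable section

namespace VacPol

/-! ### Distributions on the closed half-line and their Laplace integrals -/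

/-- Complex distributions on the real line (Mathlib's distributions: continuous real-linear maps
on real test functions, with complex values). -/
abbrev Distr : Type := 𝓓'((⊤ : Opens ℝ), ℂ)

/-- The complex-linear extension of a distribution to complex-valued test functions,
`⟨T, ψ⟩ = ⟨T, Re ψ⟩ + i ⟨T, Im ψ⟩`. -/
def pairing (T : Distr) (ψ : 𝓓((⊤ : Opens ℝ), ℂ)) : ℂ :=
  T (TestFunction.postcompCLM Complex.reCLM ψ) +
    I * T (TestFunction.postcompCLM Complex.imCLM ψ)

/-- The complex conjugate of a distribution. -/
def conjDistr (T : Distr) : Distr :=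
  Distribution.mapCLM (Complex.conjCLE : ℂ →L[ℝ] ℂ) T

/-- If `T = B(t + i0)`, this is `PP(B(t)) = (B(t + i0) + conj (B(t + i0))) / 2`. -/
def principalPart (T : Distr) : Distr :=
  (1 / 2 : ℝ) • (T + conjDistr T)

/-- `T` is the boundary value distribution `B(t + i0)`, `t ≥ 0`, of the function `B` defined in the
upper half-plane near the half-line: `⟨T, φ⟩ = lim_{ε → 0+} ∫_0^∞ B(t + iε) φ(t) dt` for all test
functions `φ`, which need not vanish near `t = 0`. So `T` is supported in `[0, ∞)`. -/
def IsBoundaryValue (B : ℂ → ℂ) (T : Distr) : Prop :=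
  ∀ φ : 𝓓((⊤ : Opens ℝ), ℝ),
    (∀ᶠ ε : ℝ in 𝓝[>] 0,
      IntegrableOn (fun t : ℝ => B (t + ε * I) * (φ t : ℂ)) (Set.Ioi 0)) ∧
    Tendsto (fun ε : ℝ => ∫ t in Set.Ioi (0 : ℝ), B (t + ε * I) * (φ t : ℂ))
      (𝓝[>] 0) (𝓝 (T φ))

/-- Approximate units: sequences of test functions, bounded together with each derivative
uniformly in the sequence index, and eventually equal to `1` on every bounded interval. -/
structure IsApproxUnit (χ : ℕ → 𝓓((⊤ : Opens ℝ), ℝ)) : Prop where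
  bounded : ∀ n : ℕ, ∃ M : ℝ, ∀ (k : ℕ) (t : ℝ), |iteratedDeriv n (χ k) t| ≤ M
  eventually_one : ∀ r : ℝ, ∀ᶠ k in atTop, ∀ t : ℝ, |t| ≤ r → χ k t = 1

/-- The test function `t ↦ χ(t) e^{-t/z}`. -/
def expTest (χ : 𝓓((⊤ : Opens ℝ), ℝ)) (z : ℂ) : 𝓓((⊤ : Opens ℝ), ℂ) where
  toFun t := (χ t : ℂ) * Complex.exp (-(t : ℂ) / z)
  contDiff' := by
    have h1 : ContDiff ℝ ∞ fun t : ℝ => (t : ℂ) := Complex.ofRealCLM.contDiff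
    have h2 : ContDiff ℝ ∞ fun t : ℝ => ((χ t : ℝ) : ℂ) :=
      Complex.ofRealCLM.contDiff.comp χ.contDiff
    exact h2.mul ((h1.neg.div_const z).cexp)
  hasCompactSupport' :=
    (χ.hasCompactSupport.comp_left (g := fun x : ℝ => (x : ℂ)) Complex.ofReal_zero).mul_right
  tsupport_subset' := by simp

/-- The integral `∫ T(t) e^{-t/z} dt` of the distribution `e^{-t/z} T` converges to `L`: the usual
notion for integrable distributions, `⟨T, χ_k e^{-t/z}⟩ → L` for every approximate unit `χ_k`. -/
def HasLaplaceIntegral (T : Distr) (z L : ℂ) : Prop :=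
  ∀ χ : ℕ → 𝓓((⊤ : Opens ℝ), ℝ), IsApproxUnit χ →
    Tendsto (fun k => pairing T (expTest (χ k) z)) atTop (𝓝 L)

/-- The Laplace-Borel integral `z⁻¹ ∫_0^∞ T(t) e^{-t/z} dt` of a distribution supported in
`[0, ∞)` converges and has the value `w`. -/
def HasLaplaceBorel (T : Distr) (z w : ℂ) : Prop :=
  ∃ L : ℂ, HasLaplaceIntegral T z L ∧ w = z⁻¹ * L

/-! ### Distributional Borel summability -/

/-- The disk `C_R = {z : Re z⁻¹ > R⁻¹}`. -/
def borelDisk (R : ℝ) : Set ℂ := {z | R⁻¹ < (z⁻¹).re}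

/-- The Borel transform `∑ cₙ tⁿ / n!` of the formal power series `∑ cₙ zⁿ` has a positive radius
of convergence, and `B` is its analytic continuation to the intersection of a neighbourhood of
`[0, ∞)` with the open upper half-plane. -/
def IsBorelContinuation (c : ℕ → ℂ) (B : ℂ → ℂ) : Prop :=
  ∃ ρ : ℝ, 0 < ρ ∧ ∃ U : Set ℂ, IsOpen U ∧ (∀ t : ℝ, 0 ≤ t → (t : ℂ) ∈ U) ∧
    (∀ t ∈ Metric.ball (0 : ℂ) ρ, HasSum (fun n : ℕ => c n / (n.factorial : ℂ) * t ^ n) (B t)) ∧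
    DifferentiableOn ℂ B (Metric.ball (0 : ℂ) ρ ∪ (U ∩ {t | 0 < t.im}))

/-- `∑ cₙ zⁿ` is Borel summable in the distributional sense to `f` on `C_R`. -/
def IsDistributionalBorelSum (c : ℕ → ℂ) (f : ℂ → ℂ) (R : ℝ) : Prop :=
  0 < R ∧ ∃ (B : ℂ → ℂ) (T : Distr), IsBorelContinuation c B ∧ IsBoundaryValue B T ∧
    ∀ z ∈ borelDisk R, HasLaplaceBorel (principalPart T) z (f z)

/-- `Φ` is the upper sum of `∑ cₙ zⁿ` on `C_R`. -/
def IsUpperSum (c : ℕ → ℂ) (Φ : ℂ → ℂ) (R : ℝ) : Prop :=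
  0 < R ∧ ∃ (B : ℂ → ℂ) (T : Distr), IsBorelContinuation c B ∧ IsBoundaryValue B T ∧
    ∀ z ∈ borelDisk R, HasLaplaceBorel T z (Φ z)

/-! ### Vacuum polarization by a uniform electric field -/

/-- The integrand of the effective action; `2 √(π α) s` is evaluated with the principal root. -/
def actionIntegrand (α : ℂ) (s : ℝ) : ℂ :=
  Complex.exp (-(I * s)) / (s : ℂ) ^ 3 *
    (2 * ((Real.pi : ℂ) * α) ^ (1 / 2 : ℂ) * s *
        (Complex.cosh (2 * ((Real.pi : ℂ) * α) ^ (1 / 2 : ℂ) * s) /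
          Complex.sinh (2 * ((Real.pi : ℂ) * α) ^ (1 / 2 : ℂ) * s))
      - 1 - 4 * Real.pi * α * (s : ℂ) ^ 2 / 3)

/-- `-(1 / 8π²)` times the integral of `actionIntegrand α` over `[0, X]`. -/
def actionPartial (α : ℂ) (X : ℝ) : ℂ :=
  -(1 / (8 * (Real.pi : ℂ) ^ 2)) * ∫ s in (0 : ℝ)..X, actionIntegrand α s

/-- The effective action `S(α)`, `|arg α| < π`: a conditionally convergent improper integral. -/
def action (α : ℂ) : ℂ := limUnder atTop (actionPartial α)

/-- `Φ(β) = S(β²)`. -/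
def Phi (β : ℂ) : ℂ := action (β ^ 2)

/-- The coefficients `aₙ`, `n ≥ 2`, of the perturbation expansion. -/
def coeffA (n : ℕ) : ℂ :=
  1 / (8 * (Real.pi : ℂ) ^ 2) * (-16 * (Real.pi : ℂ)) ^ n * ((bernoulli (2 * n) : ℚ) : ℂ) *
    ((2 * n - 3).factorial : ℂ) / ((2 * n).factorial : ℂ)

/-- The formal power series `∑_{n ≥ 2} aₙ β^{2n-3}`. -/
def seriesShifted (m : ℕ) : ℂ := if Odd m then coeffA ((m + 3) / 2) else 0

/-- The formal power series `∑_{n ≥ 2} aₙ β^{2n}`. -/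
def seriesFull (m : ℕ) : ℂ := if Even m ∧ 4 ≤ m then coeffA (m / 2) else 0

/-- `B(t) = (2√π t cot(2√π t) - 1 + 4π t² / 3) / (8π² t³)`; at the removable singularity `t = 0`
the conventions for division by zero give the correct value `B(0) = 0`. -/
def borelB (t : ℂ) : ℂ :=
  (2 * (Real.sqrt Real.pi : ℂ) * t * Complex.cot (2 * (Real.sqrt Real.pi : ℂ) * t) - 1
      + 4 * Real.pi * t ^ 2 / 3) / (8 * (Real.pi : ℂ) ^ 2 * t ^ 3)

/-- The integrand of the rotated representation of `Φ(β)`, `0 < arg β < π/2`. -/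
def rotatedIntegrand (β : ℂ) (t : ℝ) : ℂ :=
  Complex.exp (-(t : ℂ)) / (t : ℂ) ^ 3 *
    (2 * (Real.sqrt Real.pi : ℂ) * β * t *
        Complex.cot (2 * (Real.sqrt Real.pi : ℂ) * β * t)
      - 1 + 4 * Real.pi * β ^ 2 * (t : ℂ) ^ 2 / 3)

end VacPol

end

/-! The Mittag-Leffler expansion of the cotangent writes `borelB` as a sum of simple poles at ±`pole
k` with summable residues (`hasSum_poleTerm`). The positive poles lie on the path of the Laplace
integral. Two integrations soften each pole to a singularity of type w log w, so the second
primitive `primTwo` extends continuously from the upper side to the half-line, with at most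
quadratic growth (`continuousOn_primTwo`, `exists_norm_primTwo_le`). Everything is reduced to one
absolutely convergent integral, `laplaceTwo β`, the integral of primTwo(t) e^{-t/β} over t > 0.

On the distribution side, B(t + i0) is the second distributional derivative of `primTwo` on the
half-line. No point mass appears at the origin, because `primTwo` and `primOne` vanish there
(`isBoundaryValue_borelDistr`). Moving the derivatives onto e^{-t/β} gives β⁻² `laplaceTwo β`
(`hasLaplaceIntegral_halfLineDistr`), hence β⁻³ `laplaceTwo β` for the Laplace-Borel integral.

On the action side, coth x = i cot(ix) shows that the integrand of S(β²) is, up to a constant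
factor, B(βp) e^{-p} on the ray p = is (`actionIntegrand_sq`). A Jordan-type argument rotates this
conditionally convergent integral to a ray with exponential decay that still avoids the poles
(`tendsto_integral_borelRay`). There two integrations by parts replace B by `primTwo`
(`integral_borelRay_eq`), which can be rotated further, down to the ray where βp is positive
(`integral_primTwoRay`). Hence Φ(β) = `laplaceTwo β`.

The Taylor coefficients of B come from Euler's values of the zeta function at even integers.
Multiplying the formal series by β³ shifts indices by three, which on Borel transforms means passing
to the third primitive `primThree`; this is continuous up to the half-line, so its boundary value is
an ordinary function. The statements on principal parts follow from those on upper sums at β and at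
its conjugate. -/

namespace VacPol

/-! ### The function `w log w` on the closed lower half-plane -/

/-- `w log w`, with the branch of the logarithm that is continuous from below on the cut. -/
noncomputable def mulLog (w : ℂ) : ℂ := -(w * log w⁻¹)

lemma mulLog_of_mem_slitPlane {w : ℂ} (hw : w ∈ slitPlane) : mulLog w = w * log w := by
  have : w.arg ≠ Real.pi := slitPlane_arg_ne_pi hw
  rw [mulLog, log_inv _ this]; ring

lemma norm_mulLog_le (w : ℂ) : ‖mulLog w‖ ≤ ‖w‖ * |Real.log ‖w‖| + Real.pi * ‖w‖ := by
  have h : ‖log w⁻¹‖ ≤ |Real.log ‖w‖| + Real.pi := by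
    refine (Complex.norm_le_abs_re_add_abs_im _).trans (add_le_add ?_ ?_)
    · rw [log_re, norm_inv, Real.log_inv, abs_neg]
    · rw [log_im]; exact abs_arg_le_pi _
  rw [mulLog, norm_neg, norm_mul]
  nlinarith [norm_nonneg w]

lemma hasDerivAt_mulLog {w : ℂ} (hw : w ∈ slitPlane) : HasDerivAt mulLog (log w + 1) w := by
  have h0 : w ≠ 0 := slitPlane_ne_zero hw
  have h : HasDerivAt (fun w => w * log w) (1 * log w + w * w⁻¹) w :=
    (hasDerivAt_id w).mul (hasDerivAt_log hw)
  rw [one_mul, mul_inv_cancel₀ h0] at h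
  refine h.congr_of_eventuallyEq ?_
  filter_upwards [isOpen_slitPlane.mem_nhds hw] with v hv using mulLog_of_mem_slitPlane hv

lemma continuousAt_mulLog_zero : ContinuousAt mulLog 0 := by
  have h0 : mulLog 0 = 0 := by simp [mulLog]
  rw [ContinuousAt, h0]
  refine squeeze_zero_norm norm_mulLog_le ?_
  have h1 : Continuous fun w : ℂ => |‖w‖ * Real.log ‖w‖| + Real.pi * ‖w‖ := by
    have := Real.continuous_mul_log.comp (continuous_norm (E := ℂ))
    exact (this.abs).add (continuous_const.mul continuous_norm)
  have h2 := h1.tendsto 0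
  simp only [norm_zero, zero_mul, abs_zero, mul_zero, add_zero] at h2
  refine h2.congr fun w => ?_
  rw [abs_mul, abs_norm]

/-- Inversion maps the closed lower half-plane (without 0) into the closed upper one, where the
principal logarithm is continuous up to the negative axis. At 0 the factor w beats the logarithm. -/
lemma continuousOn_mulLog : ContinuousOn mulLog {w | w.im ≤ 0} := by
  intro w hw
  by_cases hs : w ∈ slitPlane
  · exact (hasDerivAt_mulLog hs).continuousAt.continuousWithinAt
  by_cases h0 : w = 0
  · subst h0; exact continuousAt_mulLog_zero.continuousWithinAt
  rw [mem_slitPlane_iff, not_or, not_lt, not_not] at hs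
  have hre : w.re < 0 := lt_of_le_of_ne hs.1 fun h => h0 (Complex.ext h hs.2)
  have hnorm : 0 < normSq w := normSq_pos.2 h0
  have hi : ContinuousWithinAt (fun w : ℂ => w⁻¹) {w | w.im ≤ 0} w :=
    (continuousAt_inv₀ h0).continuousWithinAt
  have hl : ContinuousWithinAt log {z | 0 ≤ z.im} w⁻¹ := by
    refine continuousWithinAt_log_of_re_neg_of_im_zero ?_ ?_
    · rw [inv_re]; exact div_neg_of_neg_of_pos hre hnorm
    · rw [inv_im, hs.2]; simp
  have hm : Set.MapsTo (fun w : ℂ => w⁻¹) {w | w.im ≤ 0} {z | 0 ≤ z.im} := by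
    intro v hv
    simp only [Set.mem_ofPred_eq] at hv ⊢
    rw [inv_im]
    exact div_nonneg (by linarith) (normSq_nonneg _)
  exact (continuousWithinAt_id.mul (hl.comp hi hm)).neg

/-- For small u this is log(1 + u) = O(u). For |u| > 1/2, r |log r| ≤ 1 + r² with r = |1 + u|, and
constants are absorbed by |u|. The bound ignores the branch, so it also holds on the cut; the value
100 is generous. -/
lemma norm_mulLog_one_add_le (u : ℂ) : ‖mulLog (1 + u)‖ ≤ 100 * (‖u‖ + ‖u‖ ^ 2) := by
  have hu := norm_nonneg u
  have h1 : ‖1 + u‖ ≤ 1 + ‖u‖ := by simpa using norm_add_le (1 : ℂ) u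
  have hw := norm_nonneg (1 + u)
  rcases le_or_gt ‖u‖ (1 / 2) with h | h
  · have hs : 1 + u ∈ slitPlane := mem_slitPlane_of_norm_lt_one (by linarith)
    rw [mulLog_of_mem_slitPlane hs, norm_mul]
    have := norm_log_one_add_half_le_self h
    have h3 : ‖1 + u‖ * ‖log (1 + u)‖ ≤ (1 + ‖u‖) * (3 / 2 * ‖u‖) := by gcongr
    nlinarith
  · have hlog : ‖1 + u‖ * |Real.log ‖1 + u‖| ≤ 1 + ‖1 + u‖ ^ 2 := by
      rcases le_or_gt ‖1 + u‖ 1 with h' | h'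
      · have := Real.abs_log_mul_self_lt ‖1 + u‖
        rcases hw.eq_or_lt with h0 | h0
        · rw [← h0]; norm_num
        · have := this h0 h'
          rw [abs_mul, abs_norm, mul_comm] at this
          nlinarith
      · rw [abs_of_pos (Real.log_pos h')]
        have := Real.log_le_sub_one_of_pos (by linarith : 0 < ‖1 + u‖)
        nlinarith
    have hp := norm_mulLog_le (1 + u)
    have hpi : Real.pi < 4 := Real.pi_lt_four
    nlinarith

/-! ### Poles and residues of the Borel transform -/

/-- The positive poles of `borelB`. -/
noncomputable def pole (k : ℕ) : ℝ := (k + 1) * Real.sqrt Real.pi / 2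

/-- The residues of `borelB` at its positive poles. -/
noncomputable def residue (k : ℕ) : ℝ := 1 / (2 * Real.pi ^ 3 * (k + 1) ^ 2)

/-- The upper half-plane together with a disk around the origin. -/
def upperDomain : Set ℂ := Metric.ball 0 (1 / 2) ∪ {t | 0 < t.im}

lemma isOpen_upperDomain : IsOpen upperDomain :=
  Metric.isOpen_ball.union (isOpen_lt continuous_const continuous_im)

lemma zero_mem_upperDomain : (0 : ℂ) ∈ upperDomain := Or.inl (by simp)

lemma mem_upperDomain_of_im_pos {t : ℂ} (h : 0 < t.im) : t ∈ upperDomain := Or.inr h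

/-- This follows from √π > 1, and it keeps the disk of radius 1/2 in `upperDomain` free of poles. -/
lemma half_lt_pole (k : ℕ) : 1 / 2 < pole k := by
  have h1 : 1 < Real.sqrt Real.pi := by
    rw [Real.lt_sqrt zero_le_one]; linarith [Real.pi_gt_three]
  have hk : (0 : ℝ) ≤ k := k.cast_nonneg
  unfold pole; nlinarith

lemma pole_pos (k : ℕ) : 0 < pole k := by linarith [half_lt_pole k]

lemma residue_pos (k : ℕ) : 0 < residue k := by
  unfold residue; have := Real.pi_pos; positivity

lemma summable_residue : Summable residue := by
  have h : Summable fun k : ℕ => 1 / ((k : ℝ) + 1) ^ 2 := by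
    have := (summable_nat_add_iff 1).2 (Real.summable_one_div_nat_pow.2 (by norm_num : 1 < 2))
    simpa using this
  refine (h.mul_left (1 / (2 * Real.pi ^ 3))).congr fun k => ?_
  unfold residue; rw [one_div_mul_one_div]

lemma one_add_div_mem_slitPlane {t : ℂ} (ht : t ∈ upperDomain) {a : ℝ} (ha : 1 / 2 < |a|) :
    1 + t / a ∈ slitPlane := by
  have ha0 : a ≠ 0 := by rintro rfl; norm_num at ha
  rcases ht with ht | ht
  · refine mem_slitPlane_of_norm_lt_one ?_
    rw [mem_ball_zero_iff] at ht
    rw [norm_div, norm_real, Real.norm_eq_abs, div_lt_one (by linarith)]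
    linarith
  · refine mem_slitPlane_iff.2 (Or.inr ?_)
    have : (1 + t / a).im = t.im / a := by simp [div_ofReal_im]
    rw [this]
    exact div_ne_zero (ne_of_gt ht) ha0

lemma sub_ofReal_ne_zero {t : ℂ} (ht : t ∈ upperDomain) {a : ℝ} (ha : 1 / 2 < |a|) :
    t - a ≠ 0 := by
  intro h
  rw [sub_eq_zero] at h
  rcases ht with ht | ht
  · rw [mem_ball_zero_iff, h, norm_real, Real.norm_eq_abs] at ht
    linarith
  · simp [h] at ht

lemma half_lt_abs_pole (k : ℕ) : 1 / 2 < |pole k| := by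
  rw [abs_of_pos (pole_pos k)]; exact half_lt_pole k

lemma half_lt_abs_neg_pole (k : ℕ) : 1 / 2 < |-pole k| := by
  rw [abs_neg]; exact half_lt_abs_pole k

lemma sub_pole_ne_zero {t : ℂ} (ht : t ∈ upperDomain) (k : ℕ) : t - pole k ≠ 0 :=
  sub_ofReal_ne_zero ht (half_lt_abs_pole k)

lemma add_pole_ne_zero {t : ℂ} (ht : t ∈ upperDomain) (k : ℕ) : t + pole k ≠ 0 := by
  simpa using sub_ofReal_ne_zero ht (half_lt_abs_neg_pole k)

/-- The terms of the partial fraction expansion of `borelB`. -/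
noncomputable def poleTerm (k : ℕ) (t : ℂ) : ℂ :=
  residue k * (1 / (t - pole k) + 1 / (t + pole k))

/-- This is ζ(2) = π²/6 rescaled. It splits the term 4πt²/3 of `borelB` among the poles. -/
lemma hasSum_two_div_pole_sq :
    HasSum (fun k : ℕ => 2 / (pole k : ℂ) ^ 2) (4 * (Real.pi : ℂ) / 3) := by
  have h := (hasSum_nat_add_iff' 1).2 hasSum_zeta_two
  simp only [Finset.range_one, Finset.sum_singleton, Nat.cast_zero, ne_eq, OfNat.ofNat_ne_zero,
    not_false_eq_true, zero_pow, div_zero, sub_zero] at h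
  have h2 := (h.mul_left (8 / Real.pi)).map Complex.ofRealHom Complex.continuous_ofReal
  have hpi : (Real.pi : ℂ) ≠ 0 := by exact_mod_cast Real.pi_ne_zero
  convert h2 using 1
  · ext k
    have hs : ((Real.sqrt Real.pi : ℝ) : ℂ) ^ 2 = Real.pi := by
      rw [← ofReal_pow, Real.sq_sqrt Real.pi_pos.le]
    have hk : (k : ℂ) + 1 ≠ 0 := by exact_mod_cast k.succ_ne_zero
    simp only [pole, Function.comp_apply, ofRealHom_eq_coe]
    push_cast
    rw [div_pow, mul_pow, hs]
    field_simp
    norm_num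
  · simp only [ofRealHom_eq_coe]; push_cast; field_simp; norm_num

/-- With x = 2t/√π, the expansion of πx cot(πx) − 1 has the terms 2t²/(t² − p²), where p = `pole k`.
Adding 2t²/p² from ζ(2) gives 2t⁴/(p²(t² − p²)), and division by 8π²t³ leaves simple poles of
residue 1/(8π²p²). -/
theorem hasSum_poleTerm {t : ℂ} (ht : t ∈ upperDomain) :
    HasSum (fun k => poleTerm k t) (borelB t) := by
  rcases eq_or_ne t 0 with rfl | h0
  · have h : ∀ k, poleTerm k 0 = 0 := fun k => by simp [poleTerm]
    simp only [h, borelB]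
    simp
  have hpi : (Real.pi : ℂ) ≠ 0 := by exact_mod_cast Real.pi_ne_zero
  have hs : ((Real.sqrt Real.pi : ℝ) : ℂ) ^ 2 = Real.pi := by
    rw [← ofReal_pow, Real.sq_sqrt Real.pi_pos.le]
  have hs0 : ((Real.sqrt Real.pi : ℝ) : ℂ) ≠ 0 := by
    intro h; rw [h] at hs; exact hpi (by rw [← hs]; simp)
  set r : ℂ := ((Real.sqrt Real.pi : ℝ) : ℂ) with hr
  have hp : ∀ k : ℕ, (pole k : ℂ) = (k + 1) * r / 2 := fun k => by simp [pole, hr]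
  -- An integer value n of 2t/√π would put t at the origin or at a pole; the index k = |n| − 1
  -- reflects that `pole` starts at k = 0.
  have hx : 2 * t / r ∈ integerComplement := by
    rintro ⟨n, hn⟩
    have htn : t = n * r / 2 := by rw [hn]; field_simp
    rcases lt_trichotomy n 0 with hneg | rfl | hpos
    · obtain ⟨k, hk⟩ := Int.eq_ofNat_of_zero_le (show 0 ≤ -n - 1 by omega)
      apply add_pole_ne_zero ht k
      have : (n : ℂ) = -((k : ℂ) + 1) := by
        have : n = -((k : ℤ) + 1) := by omega
        rw [this]; push_cast; ring
      rw [htn, hp, this]; ring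
    · exact h0 (by rw [htn]; simp)
    · obtain ⟨k, hk⟩ := Int.eq_ofNat_of_zero_le (show 0 ≤ n - 1 by omega)
      apply sub_pole_ne_zero ht k
      have : (n : ℂ) = (k : ℂ) + 1 := by
        have : n = (k : ℤ) + 1 := by omega
        rw [this]; push_cast; ring
      rw [htn, hp, this]; ring
  have h1 := (summable_cotTerm hx).hasSum
  have h2 : HasSum (fun n : ℕ => 1 / (2 * t / r - (n + 1)) + 1 / (2 * t / r + (n + 1)))
      (Real.pi * cot (Real.pi * (2 * t / r)) - 1 / (2 * t / r)) := by
    rw [cot_series_rep' hx]; exact h1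
  have h3 := ((h2.mul_left (2 * t / r)).add (hasSum_two_div_pole_sq.mul_left (t ^ 2))).mul_left
    (1 / (8 * (Real.pi : ℂ) ^ 2 * t ^ 3))
  have hval : borelB t = 1 / (8 * (Real.pi : ℂ) ^ 2 * t ^ 3) * (2 * t / r *
      (Real.pi * cot (Real.pi * (2 * t / r)) - 1 / (2 * t / r)) +
        t ^ 2 * (4 * (Real.pi : ℂ) / 3)) := by
    rw [borelB, ← hr]
    have e7 : (Real.pi : ℂ) * (2 * t / r) = 2 * r * t := by
      rw [← hs]; field_simp
    rw [e7]
    have e8 : 2 * t / r * (Real.pi * cot (2 * r * t) - 1 / (2 * t / r)) =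
        2 * r * t * cot (2 * r * t) - 1 := by
      rw [← hs]; field_simp
    rw [e8]
    field_simp
  rw [← hval] at h3
  have hterm : ∀ k, poleTerm k t = 1 / (8 * (Real.pi : ℂ) ^ 2 * t ^ 3) * (2 * t / r *
      (1 / (2 * t / r - (k + 1)) + 1 / (2 * t / r + (k + 1))) +
        t ^ 2 * (2 / (pole k : ℂ) ^ 2)) := by
    intro k
    have e1 := sub_pole_ne_zero ht k
    have e2 := add_pole_ne_zero ht k
    have e3 : (pole k : ℂ) ≠ 0 := by exact_mod_cast (pole_pos k).ne'
    have e4 : 2 * t / r - (k + 1) = 2 / r * (t - pole k) := by rw [hp]; field_simp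
    have e5 : 2 * t / r + (k + 1) = 2 / r * (t + pole k) := by rw [hp]; field_simp
    have e6 : (residue k : ℂ) = 1 / (8 * (Real.pi : ℂ) ^ 2 * (pole k : ℂ) ^ 2) := by
      have hk : (k : ℂ) + 1 ≠ 0 := by exact_mod_cast k.succ_ne_zero
      rw [hp, div_pow, mul_pow, hs, residue]; push_cast
      field_simp; norm_num
    rw [poleTerm, e4, e5, e6]
    field_simp
    ring
  simpa only [hterm] using h3

/-! ### The second primitive of the Borel transform -/

/-- The terms of the expansion of `primTwo`. -/
noncomputable def primTwoTerm (k : ℕ) (t : ℂ) : ℂ :=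
  residue k * (pole k * (mulLog (1 + t / pole k) - mulLog (1 + t / (-pole k : ℝ))) - 2 * t)

/-- The second primitive of `borelB`, vanishing with its derivative at the origin. It is
continuous on the closed upper half-plane near `[0, ∞)`. -/
noncomputable def primTwo (t : ℂ) : ℂ := ∑' k, primTwoTerm k t

/-- The first primitive of `borelB`. -/
noncomputable def primOne : ℂ → ℂ := deriv primTwo

/-- The factor `pole k` cancels the 1/`pole k` in the linear part of the bound for `mulLog`, and the
quadratic part keeps 1/`pole k` < 2. The bracket is thus bounded uniformly in k, and summability of
the residues does the rest. -/
lemma norm_primTwoTerm_le (k : ℕ) (t : ℂ) :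
    ‖primTwoTerm k t‖ ≤ residue k * (402 * (‖t‖ + ‖t‖ ^ 2)) := by
  have ha := pole_pos k
  have ha2 := half_lt_pole k
  have ht := norm_nonneg t
  have hb : ∀ u : ℂ, ‖u‖ = ‖t‖ / pole k →
      ‖(pole k : ℂ) * mulLog (1 + u)‖ ≤ 200 * (‖t‖ + ‖t‖ ^ 2) := by
    intro u hu
    have h := norm_mulLog_one_add_le u
    rw [norm_mul, norm_real, Real.norm_eq_abs, abs_of_pos ha]
    have h2 : pole k * ‖mulLog (1 + u)‖ ≤ pole k * (100 * (‖u‖ + ‖u‖ ^ 2)) := by gcongr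
    have h3 : pole k * (100 * (‖u‖ + ‖u‖ ^ 2)) = 100 * (‖t‖ + ‖t‖ ^ 2 / pole k) := by
      rw [hu]; field_simp
    have h4 : ‖t‖ ^ 2 / pole k ≤ 2 * ‖t‖ ^ 2 := by
      rw [div_le_iff₀ ha]; nlinarith [sq_nonneg ‖t‖]
    linarith
  have h1 := hb (t / pole k) (by
    rw [norm_div, norm_real, Real.norm_eq_abs, abs_of_pos ha])
  have h2 := hb (t / (-pole k : ℝ)) (by
    rw [norm_div, norm_real, Real.norm_eq_abs, abs_neg, abs_of_pos ha])
  rw [primTwoTerm, norm_mul, norm_real, Real.norm_eq_abs, abs_of_pos (residue_pos k)]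
  -- 402 = 200 + 200 + 2: two logarithmic terms and the linear term 2t.
  have h3 : ‖(pole k : ℂ) * (mulLog (1 + t / pole k) - mulLog (1 + t / (-pole k : ℝ))) - 2 * t‖ ≤
      402 * (‖t‖ + ‖t‖ ^ 2) := by
    rw [mul_sub]
    refine (norm_sub_le _ _).trans ?_
    have := norm_sub_le ((pole k : ℂ) * mulLog (1 + t / pole k))
      ((pole k : ℂ) * mulLog (1 + t / (-pole k : ℝ)))
    have h5 : ‖2 * t‖ = 2 * ‖t‖ := by simp
    nlinarith [sq_nonneg ‖t‖]
  exact mul_le_mul_of_nonneg_left h3 (residue_pos k).le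

lemma exists_norm_primTwo_le : ∃ C : ℝ, 0 < C ∧ ∀ t, ‖primTwo t‖ ≤ C * (‖t‖ + ‖t‖ ^ 2) := by
  refine ⟨(∑' k, residue k) * 402, ?_, fun t => ?_⟩
  · have := summable_residue.tsum_pos (fun k => (residue_pos k).le) 0 (residue_pos 0)
    positivity
  · rw [mul_assoc, ← tsum_mul_right]
    exact tsum_of_norm_bounded ((summable_residue.mul_right _).hasSum) (norm_primTwoTerm_le · t)

@[simp] lemma primTwo_zero : primTwo 0 = 0 := by
  obtain ⟨C, -, h⟩ := exists_norm_primTwo_le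
  simpa using h 0

/-- The two constants 1 in (w log w)' = log w + 1 add up to 2 and are cancelled by the term −2t.
This is what makes the first primitive vanish at the origin. -/
lemma hasDerivAt_primTwoTerm (k : ℕ) {t : ℂ} (ht : t ∈ upperDomain) :
    HasDerivAt (primTwoTerm k)
      (residue k * (log (1 + t / pole k) + log (1 + t / (-pole k : ℝ)))) t := by
  have e3 : (pole k : ℂ) ≠ 0 := by exact_mod_cast (pole_pos k).ne'
  have hd : ∀ a : ℝ, 1 / 2 < |a| →
      HasDerivAt (fun t : ℂ => mulLog (1 + t / a)) ((log (1 + t / a) + 1) * (1 / a)) t := by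
    intro a ha
    have h1 := hasDerivAt_mulLog (one_add_div_mem_slitPlane ht ha)
    exact HasDerivAt.comp (h := fun t : ℂ => 1 + t / a) t h1
      (((hasDerivAt_id t).div_const (a : ℂ)).const_add 1)
  have h := ((((hd _ (half_lt_abs_pole k)).sub (hd _ (half_lt_abs_neg_pole k))).const_mul
    (pole k : ℂ)).sub ((hasDerivAt_id t).const_mul 2)).const_mul (residue k : ℂ)
  refine h.congr_deriv ?_
  push_cast
  field_simp
  ring

lemma hasDerivAt_deriv_primTwoTerm (k : ℕ) {t : ℂ} (ht : t ∈ upperDomain) :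
    HasDerivAt (deriv (primTwoTerm k)) (poleTerm k t) t := by
  have e3 : (pole k : ℂ) ≠ 0 := by exact_mod_cast (pole_pos k).ne'
  have hd : ∀ a : ℝ, 1 / 2 < |a| →
      HasDerivAt (fun t : ℂ => log (1 + t / a)) ((1 / a) / (1 + t / a)) t := by
    intro a ha
    exact (((hasDerivAt_id t).div_const (a : ℂ)).const_add 1).clog (one_add_div_mem_slitPlane ht ha)
  have h := ((hd _ (half_lt_abs_pole k)).add (hd _ (half_lt_abs_neg_pole k))).const_mul
    (residue k : ℂ)
  have h' : HasDerivAt (fun t : ℂ => (residue k : ℂ) *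
      (log (1 + t / pole k) + log (1 + t / (-pole k : ℝ)))) (poleTerm k t) t := by
    refine h.congr_deriv ?_
    have e1 := sub_pole_ne_zero ht k
    have e2 := add_pole_ne_zero ht k
    have e4 : 1 + t / pole k = (t + pole k) / pole k := by field_simp; ring
    have e5 : 1 + t / (-pole k : ℝ) = (t - pole k) / (-pole k : ℝ) := by
      push_cast; field_simp; ring
    rw [e4, e5, poleTerm]
    push_cast
    field_simp
    ring
  refine h'.congr_of_eventuallyEq ?_
  filter_upwards [isOpen_upperDomain.mem_nhds ht] with v hv using (hasDerivAt_primTwoTerm k hv).deriv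

lemma tendstoLocallyUniformlyOn_primTwo :
    TendstoLocallyUniformlyOn (fun (s : Finset ℕ) t => ∑ k ∈ s, primTwoTerm k t) primTwo atTop
      upperDomain := by
  rw [tendstoLocallyUniformlyOn_iff_forall_isCompact isOpen_upperDomain]
  intro K _ hK
  obtain ⟨M, hM⟩ := hK.isBounded.exists_norm_le
  refine tendstoUniformlyOn_tsum (u := fun k => residue k * (402 * (M + M ^ 2)))
    (summable_residue.mul_right _) fun k t ht => (norm_primTwoTerm_le k t).trans ?_
  have := hM t ht
  have := residue_pos k
  gcongr

lemma differentiableOn_primTwo : DifferentiableOn ℂ primTwo upperDomain :=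
  tendstoLocallyUniformlyOn_primTwo.differentiableOn
    (Eventually.of_forall fun _ => DifferentiableOn.fun_sum fun k _ _ ht =>
      (hasDerivAt_primTwoTerm k ht).differentiableAt.differentiableWithinAt) isOpen_upperDomain

lemma hasDerivAt_primTwo {t : ℂ} (ht : t ∈ upperDomain) : HasDerivAt primTwo (primOne t) t :=
  ((differentiableOn_primTwo t ht).differentiableAt (isOpen_upperDomain.mem_nhds ht)).hasDerivAt

lemma hasDerivAt_sum_primTwoTerm (s : Finset ℕ) {t : ℂ} (ht : t ∈ upperDomain) :
    HasDerivAt (fun t => ∑ k ∈ s, primTwoTerm k t)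
      (∑ k ∈ s, residue k * (log (1 + t / pole k) + log (1 + t / (-pole k : ℝ)))) t :=
  HasDerivAt.fun_sum fun k _ => hasDerivAt_primTwoTerm k ht

lemma tendstoLocallyUniformlyOn_primOne :
    TendstoLocallyUniformlyOn (deriv ∘ fun (s : Finset ℕ) t => ∑ k ∈ s, primTwoTerm k t) primOne
      atTop upperDomain :=
  tendstoLocallyUniformlyOn_primTwo.deriv
    (Eventually.of_forall fun s _ ht =>
      (hasDerivAt_sum_primTwoTerm s ht).differentiableAt.differentiableWithinAt)
    isOpen_upperDomain

@[simp] lemma primOne_zero : primOne 0 = 0 := by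
  have h := tendstoLocallyUniformlyOn_primOne.tendsto_at zero_mem_upperDomain
  refine tendsto_nhds_unique h (tendsto_const_nhds.congr fun s => ?_)
  rw [Function.comp_apply, (hasDerivAt_sum_primTwoTerm s zero_mem_upperDomain).deriv]
  simp

/-- Locally uniform convergence of holomorphic functions passes to derivatives, here twice. The
second derivatives of the partial sums of `primTwo` are the partial sums of the pole expansion,
whose limit is `borelB`. -/
theorem hasDerivAt_primOne {t : ℂ} (ht : t ∈ upperDomain) : HasDerivAt primOne (borelB t) t := by
  have hdd : ∀ (s : Finset ℕ), ∀ t ∈ upperDomain,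
      HasDerivAt (deriv fun t => ∑ k ∈ s, primTwoTerm k t) (∑ k ∈ s, poleTerm k t) t := by
    intro s t ht
    have h : HasDerivAt (fun t => ∑ k ∈ s, deriv (primTwoTerm k) t) (∑ k ∈ s, poleTerm k t) t :=
      HasDerivAt.fun_sum fun k _ => hasDerivAt_deriv_primTwoTerm k ht
    refine h.congr_of_eventuallyEq ?_
    filter_upwards [isOpen_upperDomain.mem_nhds ht] with v hv
    exact (HasDerivAt.fun_sum fun k _ =>
      (hasDerivAt_primTwoTerm k hv).differentiableAt.hasDerivAt).deriv
  have hdiff : DifferentiableOn ℂ primOne upperDomain :=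
    differentiableOn_primTwo.deriv isOpen_upperDomain
  have h := (tendstoLocallyUniformlyOn_primOne.deriv
    (Eventually.of_forall fun s t ht => (hdd s t ht).differentiableAt.differentiableWithinAt)
    isOpen_upperDomain).tendsto_at ht
  have h2 : deriv primOne t = borelB t := by
    refine tendsto_nhds_unique h ((hasSum_poleTerm ht).congr fun s => ?_)
    exact (hdd s t ht).deriv.symm
  rw [← h2]
  exact ((hdiff t ht).differentiableAt (isOpen_upperDomain.mem_nhds ht)).hasDerivAt

/-- As the derivative of a holomorphic function, `borelB` is holomorphic at 0 too, with no separate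
discussion of the removable singularity. -/
theorem differentiableOn_borelB : DifferentiableOn ℂ borelB upperDomain := by
  have h : DifferentiableOn ℂ (deriv primOne) upperDomain :=
    DifferentiableOn.deriv
      (fun t ht => (hasDerivAt_primOne ht).differentiableAt.differentiableWithinAt)
      isOpen_upperDomain
  exact h.congr fun t ht => (hasDerivAt_primOne ht).deriv.symm

/-- The closed first quadrant. -/
def closedQuadrant : Set ℂ := {t | 0 ≤ t.re ∧ 0 ≤ t.im}

/-- In the closed quadrant 1 + t/p has real part at least 1, away from the cut, while 1 − t/p lies
in the closed lower half-plane, where `mulLog` is continuous even at its branch point t = p. The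
series converges uniformly on bounded sets. -/
theorem continuousOn_primTwo : ContinuousOn primTwo closedQuadrant := by
  have hterm : ∀ k, ContinuousOn (primTwoTerm k) closedQuadrant := by
    intro k
    have ha := pole_pos k
    have h1 : ContinuousOn (fun t : ℂ => mulLog (1 + t / pole k)) closedQuadrant := by
      intro t ht
      have hs : 1 + t / pole k ∈ slitPlane := by
        refine mem_slitPlane_iff.2 (Or.inl ?_)
        have : (1 + t / pole k).re = 1 + t.re / pole k := by simp [div_ofReal_re]
        rw [this]
        have := div_nonneg ht.1 ha.le
        linarith
      exact ((hasDerivAt_mulLog hs).continuousAt.comp (f := fun t : ℂ => 1 + t / pole k)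
        (by fun_prop)).continuousWithinAt
    have h2 : ContinuousOn (fun t : ℂ => mulLog (1 + t / (-pole k : ℝ))) closedQuadrant := by
      refine continuousOn_mulLog.comp (by fun_prop) fun t ht => ?_
      have : (1 + t / (-pole k : ℝ)).im = t.im / (-pole k) := by
        simp [div_ofReal_im, -ofReal_neg]
      simp only [Set.mem_ofPred_eq, this]
      exact div_nonpos_of_nonneg_of_nonpos ht.2 (by linarith)
    unfold primTwoTerm
    fun_prop
  intro t ht
  have hsub : ContinuousOn primTwo (closedQuadrant ∩ Metric.ball 0 (‖t‖ + 1)) := by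
    refine continuousOn_tsum (fun k => (hterm k).mono Set.inter_subset_left)
      (u := fun k => residue k * (402 * ((‖t‖ + 1) + (‖t‖ + 1) ^ 2)))
      (summable_residue.mul_right _) fun k s hs => (norm_primTwoTerm_le k s).trans ?_
    have h1 : ‖s‖ ≤ ‖t‖ + 1 := (mem_ball_zero_iff.1 hs.2).le
    have := residue_pos k
    gcongr
  have hb : Metric.ball (0 : ℂ) (‖t‖ + 1) ∈ 𝓝 t := Metric.isOpen_ball.mem_nhds (by simp)
  exact (hsub t ⟨ht, by simp⟩).mono_of_mem_nhdsWithin (inter_mem_nhdsWithin _ hb)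

/-! ### Taylor series of the Borel transform -/

/-- The left side is a multiple of ζ(2m + 4), which Euler's formula expresses by the Bernoulli
number of index 2(m + 2). The factorial (2n − 3)! in `coeffA` with n = m + 2 is cancelled by the
Borel factor 1/(2m + 1)!. -/
lemma hasSum_coeff (m : ℕ) :
    HasSum (fun k => -(2 * (residue k : ℂ) / (pole k : ℂ) ^ (2 * m + 2)))
      (seriesShifted (2 * m + 1) / ((2 * m + 1).factorial : ℂ)) := by
  have h := (hasSum_nat_add_iff' 1).2 (hasSum_zeta_nat (k := m + 2) (by omega))
  simp only [Finset.range_one, Finset.sum_singleton, Nat.cast_zero,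
    zero_pow (by omega : 2 * (m + 2) ≠ 0), div_zero, sub_zero] at h
  have h2 := (h.mul_left (-(1 / Real.pi ^ 3 * (4 / Real.pi) ^ (m + 1)))).map
    Complex.ofRealHom Complex.continuous_ofReal
  have hpi : (Real.pi : ℂ) ≠ 0 := by exact_mod_cast Real.pi_ne_zero
  have hs : ((Real.sqrt Real.pi : ℝ) : ℂ) ^ 2 = Real.pi := by
    rw [← ofReal_pow, Real.sq_sqrt Real.pi_pos.le]
  have hterm : ∀ k : ℕ, -(2 * (residue k : ℂ) / (pole k : ℂ) ^ (2 * m + 2)) =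
      (ofRealHom ∘ fun i : ℕ => -(1 / Real.pi ^ 3 * (4 / Real.pi) ^ (m + 1)) *
        (1 / ((i + 1 : ℕ) : ℝ) ^ (2 * (m + 2)))) k := by
    intro k
    have hk : (k : ℂ) + 1 ≠ 0 := by exact_mod_cast k.succ_ne_zero
    have hp : (pole k : ℂ) ^ (2 * m + 2) = ((k + 1) ^ 2 * Real.pi / 4) ^ (m + 1) := by
      rw [show 2 * m + 2 = 2 * (m + 1) by ring, pow_mul, pole]
      push_cast
      rw [div_pow, mul_pow, hs]; norm_num
    simp only [Function.comp_apply, ofRealHom_eq_coe]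
    rw [hp, residue]
    push_cast
    rw [show 2 * (m + 2) = 2 * (m + 1) + 2 by ring, pow_add _ (2 * (m + 1)), pow_mul]
    simp only [div_pow, mul_pow]
    field_simp
  have hval : seriesShifted (2 * m + 1) / ((2 * m + 1).factorial : ℂ) =
      ofRealHom (-(1 / Real.pi ^ 3 * (4 / Real.pi) ^ (m + 1)) *
        ((-1 : ℝ) ^ (m + 2 + 1) * (2 : ℝ) ^ (2 * (m + 2) - 1) * Real.pi ^ (2 * (m + 2)) *
        bernoulli (2 * (m + 2)) / (2 * (m + 2)).factorial)) := by
    have hodd : Odd (2 * m + 1) := ⟨m, rfl⟩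
    have e1 : (2 * m + 1 + 3) / 2 = m + 2 := by omega
    have e2 : 2 * (m + 2) - 3 = 2 * m + 1 := by omega
    have e3 : 2 * (m + 2) - 1 = 2 * (m + 1) + 1 := by omega
    have f1 : ((2 * m + 1).factorial : ℂ) ≠ 0 := by exact_mod_cast Nat.factorial_ne_zero _
    have f2 : ((2 * (m + 2)).factorial : ℂ) ≠ 0 := by exact_mod_cast Nat.factorial_ne_zero _
    rw [seriesShifted, if_pos hodd, e1, coeffA, e2, e3]
    simp only [ofRealHom_eq_coe]
    push_cast
    rw [show (-16 * (Real.pi : ℂ)) = (-1) * 4 ^ 2 * Real.pi by ring]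
    simp only [div_pow, mul_pow, pow_add, pow_mul]
    rw [show (4 : ℂ) = 2 ^ 2 by norm_num]
    have h16 : (16 : ℂ) ^ m = 4 ^ (m * 2) := by rw [mul_comm, pow_mul]; norm_num
    field_simp
    ring_nf
    rw [h16]
  rw [hval]
  exact (funext hterm) ▸ h2

/-- Each pole term is a geometric series in t²/p². Since p > 1/2, the double series is dominated by
the product of the residues with the powers of 4|t|² < 1, so it may be summed over the poles first
or over the powers first. -/
theorem hasSum_borelB {t : ℂ} (ht : t ∈ Metric.ball (0 : ℂ) (1 / 2)) :
    HasSum (fun n : ℕ => seriesShifted n / (n.factorial : ℂ) * t ^ n) (borelB t) := by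
  have htd : t ∈ upperDomain := Or.inl ht
  rw [mem_ball_zero_iff] at ht
  set F : ℕ × ℕ → ℂ :=
    fun q => -(2 * (residue q.1 : ℂ) / (pole q.1 : ℂ) ^ (2 * q.2 + 2)) * t ^ (2 * q.2 + 1) with hF
  have hlt : 4 * ‖t‖ ^ 2 < 1 := by nlinarith [norm_nonneg t]
  have hsum : Summable F := by
    have hg := summable_geometric_of_lt_one (r := 4 * ‖t‖ ^ 2) (by positivity) hlt
    have hprod := (summable_residue.mul_right (8 * ‖t‖)).mul_of_nonneg hg
      (fun k => mul_nonneg (residue_pos k).le (by positivity)) (fun m => by positivity)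
    refine Summable.of_norm_bounded hprod fun q => ?_
    have ha := pole_pos q.1
    have hr := residue_pos q.1
    have hinv : ((pole q.1) ^ 2)⁻¹ ≤ 4 := by
      rw [inv_le_comm₀ (by positivity) (by norm_num)]
      nlinarith [half_lt_pole q.1]
    have e : ‖F q‖ = residue q.1 * (2 * ‖t‖ * ((pole q.1) ^ 2)⁻¹) *
        (((pole q.1) ^ 2)⁻¹ * ‖t‖ ^ 2) ^ q.2 := by
      simp only [hF, norm_mul, norm_neg, norm_div, norm_pow, norm_real, Real.norm_eq_abs,
        abs_of_pos ha, abs_of_pos hr, norm_ofNat]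
      rw [mul_pow, inv_pow, ← pow_mul, ← pow_mul, pow_add, pow_add]
      field_simp
    rw [e]
    have h8 : 2 * ‖t‖ * ((pole q.1) ^ 2)⁻¹ ≤ 8 * ‖t‖ := by nlinarith [norm_nonneg t]
    gcongr
  have hrow : ∀ k, HasSum (fun m => F (k, m)) (poleTerm k t) := by
    intro k
    have ha := pole_pos k
    have hac : (pole k : ℂ) ≠ 0 := by exact_mod_cast ha.ne'
    have hq : ‖t ^ 2 / (pole k : ℂ) ^ 2‖ < 1 := by
      rw [norm_div, norm_pow, norm_pow, norm_real, Real.norm_eq_abs, abs_of_pos ha,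
        div_lt_one (by positivity)]
      nlinarith [half_lt_pole k, norm_nonneg t]
    have h := (hasSum_geometric_of_norm_lt_one hq).mul_left
      (-(2 * (residue k : ℂ) / (pole k : ℂ) ^ 2 * t))
    have e1 := sub_pole_ne_zero htd k
    have e2 := add_pole_ne_zero htd k
    have e3 : 1 - t ^ 2 / (pole k : ℂ) ^ 2 = -((t - pole k) * (t + pole k)) / (pole k : ℂ) ^ 2 := by
      field_simp; ring
    have hval : poleTerm k t =
        -(2 * (residue k : ℂ) / (pole k : ℂ) ^ 2 * t) * (1 - t ^ 2 / (pole k : ℂ) ^ 2)⁻¹ := by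
      rw [e3, poleTerm]
      field_simp
      ring
    have hterm : ∀ m, F (k, m) = -(2 * (residue k : ℂ) / (pole k : ℂ) ^ 2 * t) *
        (t ^ 2 / (pole k : ℂ) ^ 2) ^ m := by
      intro m
      simp only [hF]
      rw [div_pow, ← pow_mul, ← pow_mul, pow_add, pow_add]
      field_simp
    rw [hval]
    simpa only [hterm] using h
  have htot : HasSum F (borelB t) := by
    obtain ⟨S, hS⟩ := hsum
    have := hS.prod_fiberwise hrow
    rwa [(hasSum_poleTerm htd).unique this]
  have hcol := HasSum.prod_fiberwise ((Equiv.prodComm ℕ ℕ).hasSum_iff.2 htot)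
    (fun m => (hasSum_coeff m).mul_right (t ^ (2 * m + 1)))
  have hinj : Function.Injective fun m : ℕ => 2 * m + 1 := fun a b h => by
    simp only at h; omega
  -- Only odd powers occur in the column sums, and the even coefficients of `seriesShifted` are
  -- zero.
  refine (hinj.hasSum_iff ?_).1 hcol
  intro n hn
  have : ¬ Odd n := fun ⟨m, hm⟩ => hn ⟨m, hm.symm⟩
  simp [seriesShifted, this]

theorem isBorelContinuation_borelB : IsBorelContinuation seriesShifted borelB :=
  ⟨1 / 2, by norm_num, Set.univ, isOpen_univ, fun _ _ => trivial, fun _ ht => hasSum_borelB ht, by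
    simpa [upperDomain] using differentiableOn_borelB⟩

/-! ### Bounds in sectors of the upper half-plane -/

/-- Inside a sector the distance from t to a real point a is at least s|a| and at least s|t|. The
first estimate, with |a| > 1/2, gives boundedness; the second gives decay like 1/|t|. -/
lemma norm_borelB_le {s : ℝ} (hs : 0 < s) {t : ℂ} (h0 : t ≠ 0) (ht : s * ‖t‖ ≤ t.im) :
    ‖borelB t‖ ≤ 4 * (∑' k, residue k) / s ∧ ‖borelB t‖ ≤ 2 * (∑' k, residue k) / (s * ‖t‖) := by
  have hn : 0 < ‖t‖ := norm_pos_iff.2 h0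
  have him : 0 < t.im := lt_of_lt_of_le (by positivity) ht
  have htd : t ∈ upperDomain := Or.inr him
  have key : ∀ a : ℝ, s * |a| ≤ ‖t - a‖ ∧ s * ‖t‖ ≤ ‖t - a‖ := by
    intro a
    constructor
    · have h1 : |(conj t * (t - a)).im| ≤ ‖t‖ * ‖t - a‖ := by
        refine (abs_im_le_norm _).trans ?_
        rw [norm_mul, norm_conj]
      have h2 : (conj t * (t - a)).im = a * t.im := by
        simp [mul_im]; ring
      rw [h2, abs_mul, abs_of_pos him] at h1
      have h3 : |a| * (s * ‖t‖) ≤ ‖t‖ * ‖t - a‖ :=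
        (mul_le_mul_of_nonneg_left ht (abs_nonneg a)).trans h1
      nlinarith
    · refine ht.trans ?_
      have := abs_im_le_norm (t - a)
      simp only [sub_im, ofReal_im, sub_zero] at this
      exact (le_abs_self _).trans this
  have hterm : ∀ b : ℝ, 0 < b → (∀ k, b ≤ ‖t - pole k‖) → (∀ k, b ≤ ‖t - (-pole k : ℝ)‖) →
      ‖borelB t‖ ≤ (∑' k, residue k) * (2 / b) := by
    intro b hb h1 h2
    rw [← (hasSum_poleTerm htd).tsum_eq, ← tsum_mul_right]
    refine tsum_of_norm_bounded ((summable_residue.mul_right _).hasSum) fun k => ?_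
    rw [poleTerm, norm_mul, norm_real, Real.norm_eq_abs, abs_of_pos (residue_pos k)]
    refine mul_le_mul_of_nonneg_left ?_ (residue_pos k).le
    refine (norm_add_le _ _).trans ?_
    have e : t + pole k = t - (-pole k : ℝ) := by push_cast; ring
    rw [e, norm_div, norm_div, norm_one]
    have g1 := one_div_le_one_div_of_le hb (h1 k)
    have g2 := one_div_le_one_div_of_le hb (h2 k)
    calc _ ≤ 1 / b + 1 / b := add_le_add g1 g2
      _ = 2 / b := by ring
  constructor
  · refine (hterm (s / 2) (by positivity) (fun k => ?_) (fun k => ?_)).trans (le_of_eq ?_)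
    · have := half_lt_abs_pole k
      exact le_trans (by nlinarith) (key (pole k)).1
    · have := half_lt_abs_neg_pole k
      exact le_trans (by nlinarith) (key (-pole k)).1
    · field_simp; ring
  · refine (hterm (s * ‖t‖) (by positivity) (fun k => (key _).2) (fun k => (key _).2)).trans
      (le_of_eq ?_)
    field_simp

/-! ### Rotation of rays of integration -/

/-- The closed sector of all numbers `r e^{iy}` with `r ≥ 0` and `y ∈ [y₁, y₂]`. -/
def sector (y₁ y₂ : ℝ) : Set ℂ :=
  {p | ∃ r y : ℝ, 0 ≤ r ∧ y ∈ Set.Icc y₁ y₂ ∧ p = r * exp (y * I)}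

lemma continuousOn_comp_ray {h : ℂ → ℂ} {y₁ y₂ y : ℝ} (hc : ContinuousOn h (sector y₁ y₂))
    (hy : y ∈ Set.Icc y₁ y₂) : ContinuousOn (fun r : ℝ => h (r * exp (y * I))) (Set.Ici 0) :=
  hc.comp (by fun_prop) fun r hr => ⟨r, y, hr, hy, rfl⟩

/-- The exponential maps a rectangle onto the annular sector, so Cauchy's theorem for rectangles
applies to h(e^w) e^w. -/
lemma integral_ray_sub_annulus {h : ℂ → ℂ} {y₁ y₂ ε X : ℝ} (hy : y₁ ≤ y₂) (hε : 0 < ε)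
    (hX : ε ≤ X) (hc : ContinuousOn h (sector y₁ y₂))
    (hd : ∀ r y : ℝ, 0 < r → y ∈ Set.Ioo y₁ y₂ → DifferentiableAt ℂ h (r * exp (y * I))) :
    (∫ r in ε..X, h (r * exp (y₁ * I)) * exp (y₁ * I)) -
      (∫ r in ε..X, h (r * exp (y₂ * I)) * exp (y₂ * I)) +
      I * (∫ y in y₁..y₂, h (X * exp (y * I)) * (X * exp (y * I))) -
      I * (∫ y in y₁..y₂, h (ε * exp (y * I)) * (ε * exp (y * I))) = 0 := by
  have hX0 : 0 < X := hε.trans_le hX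
  have hlog : Real.log ε ≤ Real.log X := Real.log_le_log hε hX
  have hexp : ∀ x y : ℝ, exp (x + y * I) = (Real.exp x : ℝ) * exp (y * I) := fun x y => by
    rw [exp_add, ofReal_exp]
  have hpt : ∀ w : ℂ, exp w = (Real.exp w.re : ℝ) * exp (w.im * I) := fun w => by
    rw [← hexp, re_add_im]
  have key := integral_boundary_rect_eq_zero_of_continuousOn_of_differentiableOn
    (fun w => h (exp w) * exp w) (Real.log ε + y₁ * I) (Real.log X + y₂ * I)
    (by
      refine ContinuousOn.mul (hc.comp continuous_exp.continuousOn ?_) continuous_exp.continuousOn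
      intro w hw
      have hw2 := hw.2
      simp only [add_im, ofReal_im, mul_im, ofReal_re, I_im, I_re, mul_one, mul_zero, add_zero,
        zero_add, Set.mem_preimage, Set.uIcc_of_le hy] at hw2
      exact ⟨Real.exp w.re, w.im, (Real.exp_pos _).le, hw2, hpt w⟩)
    (by
      intro w hw
      have hw2 := hw.2
      simp only [add_im, ofReal_im, mul_im, ofReal_re, I_im, I_re, mul_one, mul_zero, add_zero,
        zero_add, Set.mem_preimage, min_eq_left hy, max_eq_right hy] at hw2
      have h1 := hd (Real.exp w.re) w.im (Real.exp_pos _) hw2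
      rw [← hpt] at h1
      exact ((h1.comp w differentiable_exp.differentiableAt).mul
        differentiable_exp.differentiableAt).differentiableWithinAt)
  simp only [add_re, ofReal_re, mul_re, I_re, mul_zero, ofReal_im, I_im, mul_one, sub_self,
    add_zero, add_im, mul_im, zero_add, smul_eq_mul, hexp, Real.exp_log hε, Real.exp_log hX0] at key
  have hsub : ∀ y ∈ Set.Icc y₁ y₂,
      (∫ x in Real.log ε..Real.log X, h ((Real.exp x : ℝ) * exp (y * I)) *
        ((Real.exp x : ℝ) * exp (y * I))) = ∫ r in ε..X, h (r * exp (y * I)) * exp (y * I) := by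
    intro y hy
    have h1 := intervalIntegral.integral_deriv_smul_comp'' (a := Real.log ε) (b := Real.log X)
      (f := Real.exp) (f' := Real.exp) (g := fun r : ℝ => h (r * exp (y * I)) * exp (y * I))
      Real.continuous_exp.continuousOn
      (fun x _ => (Real.hasDerivAt_exp x).hasDerivWithinAt) Real.continuous_exp.continuousOn
      (((continuousOn_comp_ray hc hy).mul continuousOn_const).mono (by
        rintro _ ⟨x, -, rfl⟩; exact (Real.exp_pos x).le))
    rw [Real.exp_log hε, Real.exp_log hX0] at h1
    rw [← h1]
    refine intervalIntegral.integral_congr fun x _ => ?_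
    simp only [Function.comp_apply, real_smul]
    ring
  rw [hsub y₁ ⟨le_rfl, hy⟩, hsub y₂ ⟨hy, le_rfl⟩] at key
  exact key

/-- Let ε → 0 in the annular version: h is bounded near the origin, so the inner arc contributes
O(ε). -/
lemma integral_ray_sub {h : ℂ → ℂ} {y₁ y₂ X : ℝ} (hy : y₁ ≤ y₂)
    (hX : 0 < X) (hc : ContinuousOn h (sector y₁ y₂))
    (hd : ∀ r y : ℝ, 0 < r → y ∈ Set.Ioo y₁ y₂ → DifferentiableAt ℂ h (r * exp (y * I))) :
    (∫ r in (0 : ℝ)..X, h (r * exp (y₁ * I)) * exp (y₁ * I)) -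
      (∫ r in (0 : ℝ)..X, h (r * exp (y₂ * I)) * exp (y₂ * I)) +
      I * (∫ y in y₁..y₂, h (X * exp (y * I)) * (X * exp (y * I))) = 0 := by
  have hprim : ∀ y ∈ Set.Icc y₁ y₂, Tendsto
      (fun ε : ℝ => ∫ r in ε..X, h (r * exp (y * I)) * exp (y * I)) (𝓝[>] 0)
      (𝓝 (∫ r in (0 : ℝ)..X, h (r * exp (y * I)) * exp (y * I))) := by
    intro y hy
    have hcont : ContinuousOn (fun r : ℝ => h (r * exp (y * I)) * exp (y * I)) (Set.uIcc 0 X) :=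
      ((continuousOn_comp_ray hc hy).mul continuousOn_const).mono (by
        rw [Set.uIcc_of_le hX.le]; exact fun r hr => hr.1)
    have h1 := intervalIntegral.continuousOn_primitive_interval_left (μ := volume)
      (hcont.integrableOn_compact isCompact_uIcc)
    have h2 := h1 0 Set.left_mem_uIcc
    have hm : Set.Ioc 0 X ∈ 𝓝[>] (0 : ℝ) := Ioc_mem_nhdsGT hX
    have h3 : 𝓝[>] (0 : ℝ) ≤ 𝓝[Set.uIcc 0 X] 0 := by
      rw [Set.uIcc_of_le hX.le]
      exact nhdsWithin_le_iff.2 (mem_of_superset hm Set.Ioc_subset_Icc_self)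
    exact h2.mono_left h3
  have harc : Tendsto (fun ε : ℝ => ∫ y in y₁..y₂, h (ε * exp (y * I)) * (ε * exp (y * I)))
      (𝓝[>] 0) (𝓝 0) := by
    have hK : IsCompact (Set.Icc (0 : ℝ) 1 ×ˢ Set.Icc y₁ y₂) := isCompact_Icc.prod isCompact_Icc
    obtain ⟨M, hM⟩ := hK.exists_bound_of_continuousOn
      (f := fun q : ℝ × ℝ => h (q.1 * exp (q.2 * I)))
      (hc.comp (by fun_prop) fun q hq => ⟨q.1, q.2, hq.1.1, hq.2, rfl⟩)
    have hlim : Tendsto (fun ε : ℝ => M * ε * |y₂ - y₁|) (𝓝[>] 0) (𝓝 0) := by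
      have : Continuous fun ε : ℝ => M * ε * |y₂ - y₁| := by fun_prop
      have := (this.tendsto 0).mono_left (nhdsWithin_le_nhds (s := Set.Ioi 0))
      simpa using this
    refine squeeze_zero_norm' ?_ hlim
    filter_upwards [Ioc_mem_nhdsGT (zero_lt_one' ℝ)] with ε hε
    refine intervalIntegral.norm_integral_le_of_norm_le_const fun y hy' => ?_
    rw [Set.uIoc_of_le hy] at hy'
    have h1 := hM (ε, y) ⟨⟨hε.1.le, hε.2⟩, hy'.1.le, hy'.2⟩
    rw [norm_mul, norm_mul, norm_exp_ofReal_mul_I, norm_real, Real.norm_eq_abs,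
      abs_of_pos hε.1, mul_one]
    exact mul_le_mul_of_nonneg_right h1 hε.1.le
  have hlim := (((hprim y₁ ⟨le_rfl, hy⟩).sub (hprim y₂ ⟨hy, le_rfl⟩)).add
    (tendsto_const_nhds (x := I * (∫ y in y₁..y₂, h (X * exp (y * I)) * (X * exp (y * I)))))).sub
      (harc.const_mul I)
  rw [mul_zero, sub_zero] at hlim
  refine tendsto_nhds_unique hlim (tendsto_const_nhds.congr' ?_)
  filter_upwards [Ioc_mem_nhdsGT hX] with ε hε
  exact (integral_ray_sub_annulus hy hε.1 hε.2 hc hd).symm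

lemma tendsto_integral_ray {h : ℂ → ℂ} {y₁ y₂ : ℝ} (hy : y₁ ≤ y₂)
    (hc : ContinuousOn h (sector y₁ y₂))
    (hd : ∀ r y : ℝ, 0 < r → y ∈ Set.Ioo y₁ y₂ → DifferentiableAt ℂ h (r * exp (y * I)))
    (harc : Tendsto (fun X : ℝ => ∫ y in y₁..y₂, h (X * exp (y * I)) * (X * exp (y * I)))
      atTop (𝓝 0)) {L : ℂ}
    (hL : Tendsto (fun X : ℝ => ∫ r in (0 : ℝ)..X, h (r * exp (y₁ * I)) * exp (y₁ * I))
      atTop (𝓝 L)) :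
    Tendsto (fun X : ℝ => ∫ r in (0 : ℝ)..X, h (r * exp (y₂ * I)) * exp (y₂ * I)) atTop (𝓝 L) := by
  have := hL.add (harc.const_mul I)
  rw [mul_zero, add_zero] at this
  refine this.congr' ?_
  filter_upwards [eventually_gt_atTop 0] with X hX
  linear_combination integral_ray_sub hy hX hc hd

/-! ### The effective action as a Laplace integral -/

lemma integrableOn_pow_mul_exp_neg (n : ℕ) {c : ℝ} (hc : 0 < c) :
    IntegrableOn (fun x : ℝ => x ^ n * Real.exp (-(c * x))) (Set.Ioi 0) := by
  have h := integrableOn_rpow_mul_exp_neg_mul_rpow (p := 1) (s := n) (b := c)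
    (by have : (0 : ℝ) ≤ n := n.cast_nonneg
        linarith) one_pos hc
  simpa using h

lemma tendsto_pow_mul_exp_neg (n : ℕ) {c : ℝ} (hc : 0 < c) :
    Tendsto (fun x : ℝ => x ^ n * Real.exp (-(c * x))) atTop (𝓝 0) := by
  simpa using tendsto_rpow_mul_exp_neg_mul_atTop_nhds_zero n c hc

lemma mul_ray_eq (β : ℂ) (r y : ℝ) :
    β * (r * exp (y * I)) = (‖β‖ * r : ℝ) * exp ((β.arg + y : ℝ) * I) := by
  conv_lhs => rw [← norm_mul_exp_arg_mul_I β]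
  push_cast
  rw [add_mul, exp_add]
  ring

lemma mul_ray_re (β : ℂ) (r y : ℝ) :
    (β * (r * exp (y * I))).re = ‖β‖ * r * Real.cos (β.arg + y) := by
  rw [mul_ray_eq, re_ofReal_mul, exp_ofReal_mul_I_re]

lemma mul_ray_im (β : ℂ) (r y : ℝ) :
    (β * (r * exp (y * I))).im = ‖β‖ * r * Real.sin (β.arg + y) := by
  rw [mul_ray_eq, im_ofReal_mul, exp_ofReal_mul_I_im]

lemma norm_mul_ray (β : ℂ) {r : ℝ} (hr : 0 ≤ r) (y : ℝ) :
    ‖β * (r * exp (y * I))‖ = ‖β‖ * r := by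
  rw [norm_mul, norm_mul, norm_exp_ofReal_mul_I, norm_real, Real.norm_of_nonneg hr, mul_one]

lemma norm_exp_neg_ray (r y : ℝ) :
    ‖exp (-(r * exp (y * I)))‖ = Real.exp (-(Real.cos y * r)) := by
  rw [norm_exp, neg_re, re_ofReal_mul, exp_ofReal_mul_I_re, mul_comm]

lemma exists_pos_le_cos {y₁ y₂ : ℝ} (h1 : -(Real.pi / 2) < y₁) (h2 : y₂ < Real.pi / 2)
    (h12 : y₁ ≤ y₂) : ∃ m : ℝ, 0 < m ∧ ∀ y ∈ Set.Icc y₁ y₂, m ≤ Real.cos y := by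
  obtain ⟨y, hy, hmin⟩ := isCompact_Icc.exists_isMinOn (Set.nonempty_Icc.2 h12)
    Real.continuous_cos.continuousOn
  exact ⟨Real.cos y, Real.cos_pos_of_mem_Ioo ⟨h1.trans_le hy.1, hy.2.trans_lt h2⟩, hmin⟩

lemma exists_pos_le_sin {y₁ y₂ : ℝ} (h1 : 0 < y₁) (h2 : y₂ < Real.pi)
    (h12 : y₁ ≤ y₂) : ∃ m : ℝ, 0 < m ∧ ∀ y ∈ Set.Icc y₁ y₂, m ≤ Real.sin y := by
  obtain ⟨y, hy, hmin⟩ := isCompact_Icc.exists_isMinOn (Set.nonempty_Icc.2 h12)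
    Real.continuous_sin.continuousOn
  exact ⟨Real.sin y, Real.sin_pos_of_mem_Ioo ⟨h1.trans_le hy.1, hy.2.trans_lt h2⟩, hmin⟩

lemma mem_upperDomain_ray {β : ℂ} (hβ : β ≠ 0) {r y : ℝ} (hr : 0 ≤ r) (h1 : -β.arg < y)
    (h2 : y < Real.pi - β.arg) : β * (r * exp (y * I)) ∈ upperDomain := by
  rcases hr.eq_or_lt with rfl | hr
  · simpa using zero_mem_upperDomain
  · refine mem_upperDomain_of_im_pos ?_
    rw [mul_ray_im]
    have := Real.sin_pos_of_mem_Ioo (x := β.arg + y) ⟨by linarith, by linarith⟩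
    have := norm_pos_iff.2 hβ
    positivity

/-- The first bound serves integrability along rays, the second compensates the length factor r on
large arcs. -/
lemma norm_borelB_ray_le {β : ℂ} (hβ : β ≠ 0) {y₁ y₂ : ℝ} (h1 : -β.arg < y₁)
    (h2 : y₂ < Real.pi - β.arg) (h12 : y₁ ≤ y₂) :
    ∃ K : ℝ, 0 < K ∧ ∀ r y : ℝ, 0 < r → y ∈ Set.Icc y₁ y₂ →
      ‖borelB (β * (r * exp (y * I)))‖ ≤ K ∧ ‖borelB (β * (r * exp (y * I)))‖ * r ≤ K := by
  obtain ⟨s, hs, hsin⟩ := exists_pos_le_sin (y₁ := β.arg + y₁) (y₂ := β.arg + y₂)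
    (by linarith) (by linarith) (by linarith)
  have hb := norm_pos_iff.2 hβ
  have hR := summable_residue.tsum_pos (fun k => (residue_pos k).le) 0 (residue_pos 0)
  refine ⟨max (4 * (∑' k, residue k) / s) (2 * (∑' k, residue k) / (s * ‖β‖)),
    lt_max_of_lt_left (by positivity), fun r y hr hy => ?_⟩
  have hn := norm_mul_ray β hr.le y
  have h0 : β * (r * exp (y * I)) ≠ 0 := by
    rw [← norm_pos_iff, hn]; positivity
  have him : s * ‖β * (r * exp (y * I))‖ ≤ (β * (r * exp (y * I))).im := by
    rw [hn, mul_ray_im, mul_comm]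
    exact mul_le_mul_of_nonneg_left (hsin _ ⟨by linarith [hy.1], by linarith [hy.2]⟩)
      (by positivity)
  obtain ⟨g1, g2⟩ := norm_borelB_le hs h0 him
  refine ⟨g1.trans (le_max_left _ _), ?_⟩
  rw [hn] at g2
  refine le_trans ?_ (le_max_right _ _)
  calc _ ≤ 2 * (∑' k, residue k) / (s * (‖β‖ * r)) * r := by gcongr
    _ = _ := by field_simp

/-- The integrand of the Laplace integral of `borelB` along the ray of angle `arg β + y`. -/
noncomputable def borelRay (β : ℂ) (y r : ℝ) : ℂ :=
  borelB (β * (r * exp (y * I))) * exp (-(r * exp (y * I))) * exp (y * I)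

lemma continuousOn_borel_sector {β : ℂ} (hβ : β ≠ 0) {y₁ y₂ : ℝ} (h1 : -β.arg < y₁)
    (h2 : y₂ < Real.pi - β.arg) :
    ContinuousOn (fun p => borelB (β * p) * exp (-p)) (sector y₁ y₂) := by
  refine ContinuousOn.mul (differentiableOn_borelB.continuousOn.comp (by fun_prop) ?_)
    (by fun_prop)
  rintro p ⟨r, y, hr, hy, rfl⟩
  exact mem_upperDomain_ray hβ hr (by linarith [hy.1]) (by linarith [hy.2])

lemma integrableOn_borelRay {β : ℂ} (hβ : β ≠ 0) {y : ℝ} (h1 : -β.arg < y)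
    (h2 : y < Real.pi - β.arg) (h3 : 0 < Real.cos y) :
    IntegrableOn (borelRay β y) (Set.Ioi 0) := by
  obtain ⟨K, hK, hb⟩ := norm_borelB_ray_le hβ h1 h2 le_rfl
  have hi := (integrableOn_pow_mul_exp_neg 0 h3).const_mul K
  refine Integrable.mono' hi ?_ ?_
  · refine ContinuousOn.aestronglyMeasurable ?_ measurableSet_Ioi
    exact ((continuousOn_comp_ray (continuousOn_borel_sector hβ h1 h2) ⟨le_rfl, le_rfl⟩).mul
      continuousOn_const).mono Set.Ioi_subset_Ici_self
  · filter_upwards [ae_restrict_mem measurableSet_Ioi] with r hr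
    have := (hb r y hr ⟨le_rfl, le_rfl⟩).1
    rw [borelRay, norm_mul, norm_mul, norm_exp_ofReal_mul_I, norm_exp_neg_ray, mul_one, pow_zero,
      one_mul]
    gcongr

/-- This is a form of Jordan's lemma. On the ray of angle π/2 the exponential has modulus 1 and only
an improper integral is available. On large arcs B(βp)p is bounded and e^{-p} has modulus at most 1,
tending to 0 at every angle below π/2, so dominated convergence makes the arcs vanish. Re β > 0
gives arg β + π/2 < π, which keeps these rays off the real axis. -/
lemma tendsto_integral_borelRay {β : ℂ} (hβ : 0 < β.re) {y : ℝ} (h1 : -β.arg < y)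
    (h2 : y < Real.pi / 2) (h3 : -(Real.pi / 2) < y) :
    Tendsto (fun X : ℝ => ∫ r in (0 : ℝ)..X, borelRay β (Real.pi / 2) r) atTop
      (𝓝 (∫ r in Set.Ioi (0 : ℝ), borelRay β y r)) := by
  have hβ0 : β ≠ 0 := by rintro rfl; simp at hβ
  have harg := abs_lt.1 (abs_arg_lt_pi_div_two_iff.2 (Or.inl hβ))
  have hcos : 0 < Real.cos y := Real.cos_pos_of_mem_Ioo ⟨h3, h2⟩
  have hc := continuousOn_borel_sector hβ0 h1 (y₂ := Real.pi / 2) (by linarith)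
  refine tendsto_integral_ray h2.le hc ?_ ?_
    (intervalIntegral_tendsto_integral_Ioi 0
      (integrableOn_borelRay hβ0 h1 (by linarith) hcos) tendsto_id)
  · intro r z hr hz
    have hm := mem_upperDomain_ray hβ0 hr.le (y := z) (by linarith [hz.1]) (by linarith [hz.2])
    have hd := (differentiableOn_borelB _ hm).differentiableAt (isOpen_upperDomain.mem_nhds hm)
    exact (DifferentiableAt.comp (f := fun p => β * p) _ hd (by fun_prop)).mul (by fun_prop)
  · obtain ⟨K, hK, hb⟩ := norm_borelB_ray_le hβ0 h1 (y₂ := Real.pi / 2) (by linarith) h2.le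
    have key := intervalIntegral.tendsto_integral_filter_of_dominated_convergence
      (μ := volume) (a := y) (b := Real.pi / 2) (l := atTop) (f := fun _ => (0 : ℂ))
      (F := fun (X : ℝ) z => borelB (β * (X * exp (z * I))) * exp (-(X * exp (z * I))) *
        (X * exp (z * I))) (fun _ => K) ?_ ?_ (by simp) ?_
    · simpa using key
    · filter_upwards [eventually_gt_atTop 0] with X hX
      rw [Set.uIoc_of_le h2.le]
      refine ContinuousOn.aestronglyMeasurable ?_ measurableSet_Ioc
      exact (hc.comp (f := fun z : ℝ => (X : ℂ) * exp (z * I)) (by fun_prop)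
        fun z hz => ⟨X, z, hX.le, ⟨hz.1.le, hz.2⟩, rfl⟩).mul (by fun_prop)
    · filter_upwards [eventually_gt_atTop 0] with X hX
      refine Eventually.of_forall fun z hz => ?_
      rw [Set.uIoc_of_le h2.le] at hz
      have g := (hb X z hX ⟨hz.1.le, hz.2⟩).2
      have hcz : 0 ≤ Real.cos z := Real.cos_nonneg_of_mem_Icc ⟨by linarith [hz.1], hz.2⟩
      rw [norm_mul, norm_mul, norm_exp_neg_ray, norm_mul, norm_exp_ofReal_mul_I, norm_real,
        Real.norm_of_nonneg hX.le, mul_one]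
      have he : Real.exp (-(Real.cos z * X)) ≤ 1 := Real.exp_le_one_iff.2 (by
        have := mul_nonneg hcz hX.le; linarith)
      calc _ = ‖borelB (β * (X * exp (z * I)))‖ * X * Real.exp (-(Real.cos z * X)) := by ring
        _ ≤ ‖borelB (β * (X * exp (z * I)))‖ * X * 1 := by gcongr
        _ ≤ K := by rw [mul_one]; exact g
    -- The endpoint angle π/2, where there is no decay, is a null set.
    · filter_upwards [compl_mem_ae_iff.2 (measure_singleton (Real.pi / 2))] with z hzne hz
      rw [Set.uIoc_of_le h2.le] at hz
      have hz2 : z < Real.pi / 2 := lt_of_le_of_ne hz.2 hzne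
      have hcz : 0 < Real.cos z := Real.cos_pos_of_mem_Ioo ⟨by linarith [hz.1], hz2⟩
      have hl := (tendsto_pow_mul_exp_neg 0 hcz).const_mul K
      rw [mul_zero] at hl
      refine squeeze_zero_norm' ?_ hl
      filter_upwards [eventually_gt_atTop 0] with X hX
      have g := (hb X z hX ⟨hz.1.le, hz.2⟩).2
      rw [norm_mul, norm_mul, norm_exp_neg_ray, norm_mul, norm_exp_ofReal_mul_I, norm_real,
        Real.norm_of_nonneg hX.le, mul_one, pow_zero, one_mul]
      calc _ = ‖borelB (β * (X * exp (z * I)))‖ * X * Real.exp (-(Real.cos z * X)) := by ring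
        _ ≤ K * Real.exp (-(Real.cos z * X)) := by gcongr

/-- The integrand of the Laplace integral of `primTwo` along the ray of angle `arg β + y`. -/
noncomputable def primTwoRay (β : ℂ) (y r : ℝ) : ℂ :=
  primTwo (β * (r * exp (y * I))) * exp (-(r * exp (y * I))) * exp (y * I)

lemma integrableOn_mul_exp_neg {g : ℝ → ℂ} (hg : ContinuousOn g (Set.Ioi 0)) {C : ℝ}
    (hb : ∀ r, 0 < r → ‖g r‖ ≤ C * (r + r ^ 2)) {κ : ℂ} (hκ : 0 < κ.re) :
    IntegrableOn (fun r : ℝ => g r * exp (-(r * κ))) (Set.Ioi 0) := by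
  have hi := ((integrableOn_pow_mul_exp_neg 1 hκ).add (integrableOn_pow_mul_exp_neg 2 hκ)).const_mul C
  refine Integrable.mono' hi ?_ ?_
  · refine ContinuousOn.aestronglyMeasurable (hg.mul (by fun_prop)) measurableSet_Ioi
  · filter_upwards [ae_restrict_mem measurableSet_Ioi] with r hr
    rw [norm_mul, norm_exp, neg_re, re_ofReal_mul, mul_comm r κ.re]
    refine (mul_le_mul_of_nonneg_right (hb r hr) (Real.exp_pos _).le).trans (le_of_eq ?_)
    simp only [Pi.add_apply]
    ring

lemma mem_closedQuadrant_ray {β : ℂ} {r y : ℝ} (hr : 0 ≤ r)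
    (h1 : -β.arg ≤ y) (h2 : y ≤ Real.pi / 2 - β.arg) :
    β * (r * exp (y * I)) ∈ closedQuadrant := by
  constructor
  · rw [mul_ray_re]
    have := Real.cos_nonneg_of_mem_Icc (x := β.arg + y) ⟨by linarith [Real.pi_pos], by linarith⟩
    positivity
  · rw [mul_ray_im]
    have := Real.sin_nonneg_of_mem_Icc (x := β.arg + y) ⟨by linarith, by linarith [Real.pi_pos]⟩
    positivity

lemma continuousOn_primTwo_sector {β : ℂ} {y₁ y₂ : ℝ} (h1 : -β.arg ≤ y₁)
    (h2 : y₂ ≤ Real.pi / 2 - β.arg) :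
    ContinuousOn (fun p => primTwo (β * p) * exp (-p)) (sector y₁ y₂) := by
  refine ContinuousOn.mul (continuousOn_primTwo.comp (by fun_prop) ?_) (by fun_prop)
  rintro p ⟨r, y, hr, hy, rfl⟩
  exact mem_closedQuadrant_ray hr (by linarith [hy.1]) (by linarith [hy.2])

lemma exists_norm_primTwo_ray_le (β : ℂ) : ∃ C : ℝ, 0 < C ∧ ∀ r y : ℝ, 0 ≤ r →
    ‖primTwo (β * (r * exp (y * I)))‖ ≤ C * (r + r ^ 2) := by
  obtain ⟨C, hC, h⟩ := exists_norm_primTwo_le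
  refine ⟨C * (‖β‖ + ‖β‖ ^ 2 + 1), by positivity, fun r y hr => (h _).trans ?_⟩
  rw [norm_mul_ray β hr, mul_assoc]
  have := norm_nonneg β
  gcongr
  nlinarith [mul_nonneg this hr, mul_nonneg (sq_nonneg ‖β‖) hr, mul_nonneg this (sq_nonneg r)]

lemma integrableOn_primTwoRay {β : ℂ} {y : ℝ} (h1 : -β.arg ≤ y) (h2 : y ≤ Real.pi / 2 - β.arg)
    (h3 : 0 < Real.cos y) : IntegrableOn (primTwoRay β y) (Set.Ioi 0) := by
  obtain ⟨C, -, hb⟩ := exists_norm_primTwo_ray_le β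
  refine (integrableOn_mul_exp_neg (g := fun r => primTwo (β * (r * exp (y * I))))
    (κ := exp (y * I)) ?_ (fun r hr => hb r y hr.le) (by rwa [exp_ofReal_mul_I_re])).mul_const _
  exact continuousOn_primTwo.comp (by fun_prop) fun r hr => mem_closedQuadrant_ray (le_of_lt hr) h1 h2

/-- At the angle −arg β the point βp is positive and B has poles, but `primTwo` is continuous there.
On the angles involved cos is bounded below by a positive constant, so the exponential beats the
polynomial growth on the arcs. -/
lemma integral_primTwoRay {β : ℂ} (hβ : 0 < β.re) {y : ℝ} (h1 : -β.arg ≤ y)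
    (h2 : y ≤ Real.pi / 2 - β.arg) (h3 : y < Real.pi / 2) :
    ∫ r in Set.Ioi (0 : ℝ), primTwoRay β y r = ∫ r in Set.Ioi (0 : ℝ), primTwoRay β (-β.arg) r := by
  have hβ0 : β ≠ 0 := by rintro rfl; simp at hβ
  have harg := abs_lt.1 (abs_arg_lt_pi_div_two_iff.2 (Or.inl hβ))
  obtain ⟨m, hm, hcos⟩ := exists_pos_le_cos (y₁ := -β.arg) (y₂ := y) (by linarith) h3 h1
  have hc := continuousOn_primTwo_sector (y₁ := -β.arg) le_rfl h2
  refine tendsto_nhds_unique (intervalIntegral_tendsto_integral_Ioi 0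
    (integrableOn_primTwoRay h1 h2 (hm.trans_le (hcos y ⟨h1, le_rfl⟩))) tendsto_id) ?_
  refine tendsto_integral_ray h1 hc ?_ ?_ (intervalIntegral_tendsto_integral_Ioi 0
    (integrableOn_primTwoRay le_rfl (by linarith) (hm.trans_le (hcos _ ⟨le_rfl, h1⟩))) tendsto_id)
  · intro r z hr hz
    have hm := mem_upperDomain_ray hβ0 hr.le (y := z) (by linarith [hz.1])
      (by linarith [hz.2, Real.pi_pos])
    exact (DifferentiableAt.comp (f := fun p => β * p) _ (hasDerivAt_primTwo hm).differentiableAt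
      (by fun_prop)).mul (by fun_prop)
  · obtain ⟨C, hC, hb⟩ := exists_norm_primTwo_ray_le β
    have hl := (((tendsto_pow_mul_exp_neg 2 hm).add (tendsto_pow_mul_exp_neg 3 hm)).const_mul
      C).mul_const |y - -β.arg|
    simp only [add_zero, mul_zero, zero_mul] at hl
    refine squeeze_zero_norm' ?_ hl
    filter_upwards [eventually_gt_atTop 0] with X hX
    refine intervalIntegral.norm_integral_le_of_norm_le_const fun z hz => ?_
    rw [Set.uIoc_of_le h1] at hz
    have g := hb X z hX.le
    have hcz := hcos z ⟨hz.1.le, hz.2⟩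
    rw [norm_mul, norm_mul, norm_exp_neg_ray, norm_mul, norm_exp_ofReal_mul_I, norm_real,
      Real.norm_of_nonneg hX.le, mul_one]
    calc _ ≤ C * (X + X ^ 2) * Real.exp (-(m * X)) * X := by gcongr
      _ = _ := by ring

/-- Two integrations by parts done at once: the difference of the two integrands has the explicit
primitive of `hQ`, which vanishes at 0 because `primOne` and `primTwo` do, and at infinity by
exponential decay. -/
lemma integral_borelRay_eq {β : ℂ} (hβ : β ≠ 0) {y : ℝ} (h1 : -β.arg < y)
    (h2 : y ≤ Real.pi / 2 - β.arg) (h3 : 0 < Real.cos y) :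
    ∫ r in Set.Ioi (0 : ℝ), borelRay β y r =
      (β ^ 2)⁻¹ * ∫ r in Set.Ioi (0 : ℝ), primTwoRay β y r := by
  have hpi := Real.pi_pos
  have hIB := integrableOn_borelRay hβ h1 (by linarith) h3
  have hIG := integrableOn_primTwoRay h1.le h2 h3
  rw [← sub_eq_zero, ← integral_const_mul, ← integral_sub hIB (hIG.const_mul _)]
  set e : ℂ := exp (y * I) with he
  have hmem : ∀ r : ℝ, 0 ≤ r → β * (r * e) ∈ upperDomain := fun r hr =>
    mem_upperDomain_ray hβ hr h1 (by linarith)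
  have hray : ∀ r : ℝ, HasDerivAt (fun r : ℝ => β * (r * e)) (β * e) r := fun r => by
    simpa using ((hasDerivAt_id r).ofReal_comp.mul_const e).const_mul β
  have hd1 : ∀ r : ℝ, 0 ≤ r →
      HasDerivAt (fun r : ℝ => primOne (β * (r * e))) (borelB (β * (r * e)) * (β * e)) r :=
    fun r hr => (hasDerivAt_primOne (hmem r hr)).comp r (hray r)
  have hd2 : ∀ r : ℝ, 0 ≤ r →
      HasDerivAt (fun r : ℝ => primTwo (β * (r * e))) (primOne (β * (r * e)) * (β * e)) r :=
    fun r hr => HasDerivAt.comp (h₂ := primTwo) r (hasDerivAt_primTwo (hmem r hr)) (hray r)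
  have hde : ∀ r : ℝ, HasDerivAt (fun r : ℝ => exp (-(r * e))) (exp (-(r * e)) * (-e)) r :=
    fun r => by
      simpa using (((hasDerivAt_id r).ofReal_comp.mul_const e).neg).cexp
  have hQ : ∀ r : ℝ, 0 ≤ r → HasDerivAt
      (fun r : ℝ => β⁻¹ * (exp (-(r * e)) * (primOne (β * (r * e)) + β⁻¹ * primTwo (β * (r * e)))))
      (borelRay β y r - (β ^ 2)⁻¹ * primTwoRay β y r) r := by
    intro r hr
    have h := ((hde r).mul ((hd1 r hr).add ((hd2 r hr).const_mul β⁻¹))).const_mul β⁻¹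
    refine h.congr_deriv ?_
    simp only [borelRay, primTwoRay, ← he, Pi.add_apply]
    field_simp
    ring
  have hlim : Tendsto (fun r : ℝ => β⁻¹ * (exp (-(r * e)) *
      (primOne (β * (r * e)) + β⁻¹ * primTwo (β * (r * e))))) atTop (𝓝 0) := by
    obtain ⟨K, hK, hb⟩ := norm_borelB_ray_le hβ h1 (y₂ := y) (by linarith) le_rfl
    obtain ⟨C, hC, hbC⟩ := exists_norm_primTwo_ray_le β
    -- `primOne` grows at most linearly along the ray, since it vanishes at 0 and its derivative B
    -- is bounded there.
    have hone : ∀ r : ℝ, 0 < r → ‖primOne (β * (r * e))‖ ≤ K * ‖β‖ * r := by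
      intro r hr
      have := norm_image_sub_le_of_norm_deriv_le_segment' (f := fun r : ℝ => primOne (β * (r * e)))
        (f' := fun r => borelB (β * (r * e)) * (β * e)) (a := 0) (b := r) (C := K * ‖β‖)
        (fun x hx => (hd1 x hx.1).hasDerivWithinAt) (fun x hx => by
          rw [norm_mul, norm_mul, he, norm_exp_ofReal_mul_I, mul_one]
          rcases hx.1.eq_or_lt with h0 | h0
          · rw [← h0]; simp [borelB]; positivity
          · have := (hb x y h0 ⟨le_rfl, le_rfl⟩).1
            gcongr) r ⟨hr.le, le_rfl⟩
      simpa using this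
    have hl := (((tendsto_pow_mul_exp_neg 1 h3).const_mul (K * ‖β‖)).add
      (((tendsto_pow_mul_exp_neg 1 h3).add (tendsto_pow_mul_exp_neg 2 h3)).const_mul
        (‖β⁻¹‖ * C))).const_mul ‖β⁻¹‖
    simp only [add_zero, mul_zero] at hl
    refine squeeze_zero_norm' ?_ hl
    filter_upwards [eventually_gt_atTop 0] with r hr
    have g1 := hone r hr
    have g2 := hbC r y hr.le
    rw [norm_mul, norm_mul, norm_exp_neg_ray]
    refine mul_le_mul_of_nonneg_left ?_ (norm_nonneg _)
    have g3 : ‖primOne (β * (r * e)) + β⁻¹ * primTwo (β * (r * e))‖ ≤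
        K * ‖β‖ * r + ‖β⁻¹‖ * (C * (r + r ^ 2)) := by
      refine (norm_add_le _ _).trans (add_le_add g1 ?_)
      rw [norm_mul]
      exact mul_le_mul_of_nonneg_left g2 (norm_nonneg _)
    refine (mul_le_mul_of_nonneg_left g3 (Real.exp_pos _).le).trans (le_of_eq ?_)
    ring
  rw [integral_Ioi_of_hasDerivAt_of_tendsto (hQ 0 le_rfl).continuousAt.continuousWithinAt
    (fun r hr => hQ r (le_of_lt hr)) (hIB.sub (hIG.const_mul _)) hlim]
  simp

/-- The Laplace integral of the second primitive of `borelB`. -/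
noncomputable def laplaceTwo (β : ℂ) : ℂ :=
  ∫ t in Set.Ioi (0 : ℝ), primTwo t * exp (-(t : ℂ) / β)

/-- Since e^{-i arg β} = |β|/β, the substitution t = |β| r turns e^{-p} into e^{-t/β}. -/
lemma integral_primTwoRay_neg_arg {β : ℂ} (hβ : β ≠ 0) :
    ∫ r in Set.Ioi (0 : ℝ), primTwoRay β (-β.arg) r = β⁻¹ * laplaceTwo β := by
  have hb := norm_pos_iff.2 hβ
  have hbc : (‖β‖ : ℂ) ≠ 0 := by exact_mod_cast hb.ne'
  have he : exp ((-β.arg : ℝ) * I) = ‖β‖ / β := by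
    rw [eq_div_iff hβ]
    conv_lhs => rw [← norm_mul_exp_arg_mul_I β]
    rw [mul_left_comm, ← exp_add]
    simp
  have h := integral_comp_mul_left_Ioi (fun t : ℝ => primTwo t * exp (-(t : ℂ) / β)) 0 hb
  rw [mul_zero] at h
  have hpt : ∀ r : ℝ, primTwoRay β (-β.arg) r =
      (primTwo ((‖β‖ * r : ℝ) : ℂ) * exp (-((‖β‖ * r : ℝ) : ℂ) / β)) * (‖β‖ / β) := by
    intro r
    rw [primTwoRay, he]
    congr 2
    · congr 1; push_cast; field_simp
    · congr 1; push_cast; field_simp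
  simp only [hpt]
  rw [integral_mul_const, h, laplaceTwo, real_smul]
  push_cast
  field_simp

theorem integral_borelRay {β : ℂ} (hβ : 0 < β.re) {y : ℝ} (h1 : -β.arg < y)
    (h2 : y < Real.pi / 2) (h3 : -(Real.pi / 2) < y) :
    ∫ r in Set.Ioi (0 : ℝ), borelRay β y r = (β ^ 3)⁻¹ * laplaceTwo β := by
  have hβ0 : β ≠ 0 := by rintro rfl; simp at hβ
  have harg := abs_lt.1 (abs_arg_lt_pi_div_two_iff.2 (Or.inl hβ))
  -- The bisector of the angles −arg β and π/2 satisfies every constraint, in particular y ≤ π/2 −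
  -- arg β, which keeps βp in the closed quadrant. A general y may violate this, so it is compared
  -- with the bisector through their common limit at angle π/2.
  have hcos : 0 < Real.cos (Real.pi / 4 - β.arg / 2) :=
    Real.cos_pos_of_mem_Ioo ⟨by linarith, by linarith⟩
  rw [tendsto_nhds_unique (tendsto_integral_borelRay hβ h1 h2 h3)
    (tendsto_integral_borelRay hβ (y := Real.pi / 4 - β.arg / 2) (by linarith) (by linarith)
      (by linarith)), integral_borelRay_eq hβ0 (by linarith) (by linarith) hcos,
    integral_primTwoRay hβ (by linarith) (by linarith) (by linarith),
    integral_primTwoRay_neg_arg hβ0]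
  field_simp

/-- Re β > 0 makes √π β the principal root of πβ². Substituting is for p changes cot into −i coth,
the sign of the quadratic term, and p³ into −is³. -/
lemma actionIntegrand_sq {β : ℂ} (hβ : 0 < β.re) (s : ℝ) :
    actionIntegrand (β ^ 2) s =
      -(8 * (Real.pi : ℂ) ^ 2) * β ^ 3 * borelRay β (Real.pi / 2) s := by
  have hβ0 : β ≠ 0 := by rintro rfl; simp at hβ
  have hpi : (Real.pi : ℂ) ≠ 0 := by exact_mod_cast Real.pi_ne_zero
  have hs : ((Real.sqrt Real.pi : ℝ) : ℂ) ^ 2 = Real.pi := by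
    rw [← ofReal_pow, Real.sq_sqrt Real.pi_pos.le]
  have hroot : ((Real.pi : ℂ) * β ^ 2) ^ (1 / 2 : ℂ) = (Real.sqrt Real.pi : ℂ) * β := by
    rw [← hs, ← mul_pow, one_div, sq_cpow_two_inv]
    rw [re_ofReal_mul]
    have := Real.sqrt_pos.2 Real.pi_pos
    positivity
  have hI : exp ((Real.pi / 2 : ℝ) * I) = I := by push_cast; exact exp_pi_div_two_mul_I
  rw [borelRay, hI, actionIntegrand, hroot, borelB]
  rcases eq_or_ne s 0 with rfl | hs0
  · simp
  have hsc : (s : ℂ) ≠ 0 := by exact_mod_cast hs0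
  set r : ℂ := ((Real.sqrt Real.pi : ℝ) : ℂ)
  have hcot : cot (2 * r * (β * (s * I))) =
      -I * (cosh (2 * (r * β) * s) / sinh (2 * (r * β) * s)) := by
    rw [show 2 * r * (β * (s * I)) = (2 * (r * β) * s) * I by ring, cot, cos_mul_I, sin_mul_I]
    rw [div_mul_eq_div_div, div_I]; ring
  rw [hcot, show -((s : ℂ) * I) = -(I * s) by ring]
  have hI2 : I ^ 2 = -1 := I_sq
  have hI3 : I ^ 3 = -I := by rw [pow_succ, I_sq]; ring
  set q := cosh (2 * (r * β) * s) / sinh (2 * (r * β) * s)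
  simp only [mul_pow, hI3, hI2]
  field_simp
  ring_nf
  simp only [hI2]
  ring

theorem tendsto_actionPartial {β : ℂ} (hβ : 0 < β.re) :
    Tendsto (actionPartial (β ^ 2)) atTop (𝓝 (laplaceTwo β)) := by
  have hβ0 : β ≠ 0 := by rintro rfl; simp at hβ
  have hpi : (Real.pi : ℂ) ≠ 0 := by exact_mod_cast Real.pi_ne_zero
  have harg := abs_lt.1 (abs_arg_lt_pi_div_two_iff.2 (Or.inl hβ))
  have h := (tendsto_integral_borelRay hβ (y := Real.pi / 4 - β.arg / 2) (by linarith)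
    (by linarith) (by linarith)).const_mul (β ^ 3)
  rw [integral_borelRay hβ (by linarith) (by linarith) (by linarith), ← mul_assoc,
    mul_inv_cancel₀ (pow_ne_zero 3 hβ0), one_mul] at h
  refine h.congr fun X => ?_
  rw [actionPartial]
  simp only [actionIntegrand_sq hβ, intervalIntegral.integral_const_mul]
  field_simp

theorem Phi_eq_laplaceTwo {β : ℂ} (hβ : 0 < β.re) : Phi β = laplaceTwo β :=
  (tendsto_actionPartial hβ).limUnder_eq

lemma rotatedIntegrand_eq (β : ℂ) (hβ : β ≠ 0) (t : ℝ) :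
    rotatedIntegrand β t = 8 * (Real.pi : ℂ) ^ 2 * β ^ 3 * borelRay β 0 t := by
  rw [rotatedIntegrand, borelRay, borelB]
  rcases eq_or_ne t 0 with rfl | ht0
  · simp
  have htc : (t : ℂ) ≠ 0 := by exact_mod_cast ht0
  have hpi : (Real.pi : ℂ) ≠ 0 := by exact_mod_cast Real.pi_ne_zero
  simp only [ofReal_zero, zero_mul, exp_zero, mul_one]
  rw [show 2 * (Real.sqrt Real.pi : ℂ) * β * t = 2 * (Real.sqrt Real.pi : ℂ) * (β * t) by ring]
  field_simp

theorem rotated_representation {β : ℂ} (h1 : 0 < β.arg) (h2 : β.arg < Real.pi / 2) :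
    IntegrableOn (rotatedIntegrand β) (Set.Ioi 0) ∧
      Phi β = 1 / (8 * (Real.pi : ℂ) ^ 2) * ∫ t in Set.Ioi (0 : ℝ), rotatedIntegrand β t := by
  have hβ0 : β ≠ 0 := by rintro rfl; simp at h1
  have hpi : (Real.pi : ℂ) ≠ 0 := by exact_mod_cast Real.pi_ne_zero
  have hpi' := Real.pi_pos
  have hre : 0 < β.re := (abs_arg_lt_pi_div_two_iff.1 (abs_lt.2 ⟨by linarith, h2⟩)).resolve_right hβ0
  have hfun : rotatedIntegrand β = fun t => 8 * (Real.pi : ℂ) ^ 2 * β ^ 3 * borelRay β 0 t :=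
    funext (rotatedIntegrand_eq β hβ0)
  rw [hfun]
  refine ⟨(integrableOn_borelRay hβ0 (by linarith) (by linarith) (by simp)).const_mul _, ?_⟩
  rw [integral_const_mul, integral_borelRay hre (by linarith) (by linarith) (by linarith),
    Phi_eq_laplaceTwo hre]
  field_simp

/-! ### Derivatives of continuous functions on the half-line as distributions -/

/-- The distribution `φ ↦ ∫_0^∞ g(t) φ⁽ʲ⁾(t) dt`. -/
noncomputable def halfLineDistr (g : ℝ → ℂ) : ℕ → Distr
  | 0 => TestFunction.integralAgainstBilinCLM
      (ContinuousLinearMap.lsmul ℝ ℝ : ℝ →L[ℝ] ℂ →L[ℝ] ℂ) (volume.restrict (Set.Ioi 0)) g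
  | j + 1 => -Distribution.lineDerivCLM (1 : ℝ) (halfLineDistr g j)

lemma locallyIntegrableOn_halfLine {g : ℝ → ℂ} (hg : ContinuousOn g (Set.Ici 0)) :
    LocallyIntegrableOn g ((⊤ : Opens ℝ) : Set ℝ) (volume.restrict (Set.Ioi 0)) := by
  rw [Opens.coe_top, locallyIntegrableOn_univ, locallyIntegrable_iff]
  intro K hK
  rw [IntegrableOn, Measure.restrict_restrict hK.measurableSet]
  have h : IntegrableOn g (K ∩ Set.Ici 0) :=
    (hg.mono Set.inter_subset_right).integrableOn_compact (hK.inter_right isClosed_Ici)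
  exact h.mono_set (Set.inter_subset_inter_right _ Set.Ioi_subset_Ici_self)

lemma halfLineDistr_apply {g : ℝ → ℂ} (hg : ContinuousOn g (Set.Ici 0)) (j : ℕ)
    (φ : 𝓓((⊤ : Opens ℝ), ℝ)) :
    halfLineDistr g j φ = ∫ t in Set.Ioi (0 : ℝ), ((iteratedDeriv j φ t : ℝ) : ℂ) * g t := by
  induction j generalizing φ with
  | zero =>
    have h : halfLineDistr g 0 φ = ∫ t in Set.Ioi (0 : ℝ), φ t • g t :=
      TestFunction.integralAgainstBilinCLM_eq_integral (locallyIntegrableOn_halfLine hg)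
    simpa using h
  | succ j ih =>
    have h : halfLineDistr g (j + 1) φ =
        halfLineDistr g j (TestFunction.lineDerivCLM ℝ (1 : ℝ) φ) := by
      -- The sign in the definition of `halfLineDistr` cancels the sign in the definition of the
      -- distributional derivative, so no factor (−1)^j appears.
      rw [halfLineDistr, neg_apply, Distribution.lineDerivCLM_apply, neg_neg]
    rw [h, ih, iteratedDeriv_succ']
    have hd : (TestFunction.lineDerivCLM ℝ (1 : ℝ) φ : 𝓓((⊤ : Opens ℝ), ℝ)) = deriv φ := by
      ext t
      refine (TestFunction.lineDerivCLM_apply_of_le (𝕜 := ℝ) (n := ⊤) (k := ⊤) le_top).trans ?_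
      simp [lineDeriv, deriv_comp_const_add]
    rw [hd]

lemma iteratedDeriv_clm_comp {E F : Type*} [NormedAddCommGroup E] [NormedSpace ℝ E]
    [NormedAddCommGroup F] [NormedSpace ℝ F] (L : E →L[ℝ] F) {f : ℝ → E} (hf : ContDiff ℝ ∞ f)
    (j : ℕ) (t : ℝ) : iteratedDeriv j (fun t => L (f t)) t = L (iteratedDeriv j f t) := by
  have := L.iteratedFDeriv_comp_left (x := t) (i := j) (hf.contDiffAt)
    (by exact_mod_cast le_top)
  rw [iteratedDeriv_eq_iteratedFDeriv, iteratedDeriv_eq_iteratedFDeriv]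
  change iteratedFDeriv ℝ j (L ∘ f) t _ = _
  rw [this]
  rfl

lemma pairing_halfLineDistr {g : ℝ → ℂ} (hg : ContinuousOn g (Set.Ici 0)) (j : ℕ)
    (ψ : 𝓓((⊤ : Opens ℝ), ℂ)) :
    pairing (halfLineDistr g j) ψ = ∫ t in Set.Ioi (0 : ℝ), iteratedDeriv j ψ t * g t := by
  have hint : ∀ L : ℂ →L[ℝ] ℝ, IntegrableOn (fun t => ((L (iteratedDeriv j ψ t) : ℝ) : ℂ) * g t)
      (Set.Ioi 0) := by
    intro L
    have hc : Continuous (iteratedDeriv j ψ) :=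
      ψ.contDiff.continuous_iteratedDeriv j (by exact_mod_cast le_top)
    have hs : HasCompactSupport (iteratedDeriv j ψ) := by
      rw [iteratedDeriv_eq_equiv_comp]
      exact (ψ.hasCompactSupport.iteratedFDeriv j).comp_left (by simp)
    have h2 : IntegrableOn (fun t => ((L (iteratedDeriv j ψ t) : ℝ) : ℂ) * g t)
        (tsupport (iteratedDeriv j ψ) ∩ Set.Ici 0) := by
      refine ContinuousOn.integrableOn_compact (hs.isCompact.inter_right isClosed_Ici) ?_
      have h1 : Continuous fun t => ((L (iteratedDeriv j ψ t) : ℝ) : ℂ) := by fun_prop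
      exact h1.continuousOn.mul (hg.mono Set.inter_subset_right)
    have h3 : IntegrableOn (fun t => ((L (iteratedDeriv j ψ t) : ℝ) : ℂ) * g t) (Set.Ici 0) := by
      refine h2.of_forall_sdiff_eq_zero measurableSet_Ici fun t ht => ?_
      have : iteratedDeriv j ψ t = 0 := image_eq_zero_of_notMem_tsupport fun h => ht.2 ⟨h, ht.1⟩
      simp [this]
    exact h3.mono_set Set.Ioi_subset_Ici_self
  rw [pairing, halfLineDistr_apply hg, halfLineDistr_apply hg, ← integral_const_mul,
    ← integral_add]
  · refine integral_congr_ae (Eventually.of_forall fun t => ?_)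
    have h1 := iteratedDeriv_clm_comp reCLM ψ.contDiff j t
    have h2 := iteratedDeriv_clm_comp imCLM ψ.contDiff j t
    have e1 : iteratedDeriv j (TestFunction.postcompCLM reCLM ψ) t = (iteratedDeriv j ψ t).re := h1
    have e2 : iteratedDeriv j (TestFunction.postcompCLM imCLM ψ) t = (iteratedDeriv j ψ t).im := h2
    simp only [e1, e2]
    conv_rhs => rw [← re_add_im (iteratedDeriv j ψ t)]
    ring
  · have h1 : ∀ t, iteratedDeriv j (TestFunction.postcompCLM reCLM ψ) t = _ :=
      iteratedDeriv_clm_comp reCLM ψ.contDiff j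
    simp only [h1]
    exact hint reCLM
  · have h2 : ∀ t, iteratedDeriv j (TestFunction.postcompCLM imCLM ψ) t = _ :=
      iteratedDeriv_clm_comp imCLM ψ.contDiff j
    simp only [h2]
    exact (hint imCLM).const_mul I

/-! ### Laplace integrals -/

lemma contDiff_exp_neg_div (z : ℂ) : ContDiff ℝ ∞ fun t : ℝ => exp (-(t : ℂ) / z) := by
  have h1 : ContDiff ℝ ∞ fun t : ℝ => (t : ℂ) := Complex.ofRealCLM.contDiff
  exact (h1.neg.div_const z).cexp

lemma iteratedDeriv_exp_neg_div (z : ℂ) (j : ℕ) (t : ℝ) :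
    iteratedDeriv j (fun t : ℝ => exp (-(t : ℂ) / z)) t = (-z⁻¹) ^ j * exp (-(t : ℂ) / z) := by
  induction j generalizing t with
  | zero => simp
  | succ j ih =>
    rw [iteratedDeriv_succ, funext ih]
    have h : HasDerivAt (fun t : ℝ => exp (-(t : ℂ) / z)) (exp (-(t : ℂ) / z) * (-1 / z)) t := by
      simpa using (((hasDerivAt_id t).ofReal_comp.neg).div_const z).cexp
    rw [(h.const_mul _).deriv]
    ring

/-- By the Leibniz rule the j-th derivative of χₖ e^{-t/z} is bounded by a constant, uniform in k,
times |e^{-t/z}|; this uses the uniform bounds on the derivatives of χₖ. Pointwise it is eventually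
(−1/z)^j e^{-t/z}, so dominated convergence applies. -/
theorem hasLaplaceIntegral_halfLineDistr {g : ℝ → ℂ} (hg : ContinuousOn g (Set.Ici 0)) (j : ℕ)
    {z : ℂ} (hint : IntegrableOn (fun t : ℝ => g t * exp (-(t : ℂ) / z)) (Set.Ioi 0)) :
    HasLaplaceIntegral (halfLineDistr g j) z
      ((-z⁻¹) ^ j * ∫ t in Set.Ioi (0 : ℝ), g t * exp (-(t : ℂ) / z)) := by
  intro χ hχ
  choose M hM using hχ.bounded
  simp only [pairing_halfLineDistr hg]
  rw [← integral_const_mul]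
  have hfun : ∀ k, (expTest (χ k) z : ℝ → ℂ) =
      (fun t => ((χ k t : ℝ) : ℂ)) * fun t : ℝ => exp (-(t : ℂ) / z) := fun k => rfl
  have hχc : ∀ k, ContDiff ℝ ∞ fun t => ((χ k t : ℝ) : ℂ) := fun k =>
    Complex.ofRealCLM.contDiff.comp (χ k).contDiff
  have hbound : ∀ k t, ‖iteratedDeriv j (expTest (χ k) z) t‖ ≤
      (∑ i ∈ Finset.range (j + 1), j.choose i * M i * ‖z⁻¹‖ ^ (j - i)) *
        ‖exp (-(t : ℂ) / z)‖ := by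
    intro k t
    rw [hfun, iteratedDeriv_mul ((hχc k).contDiffAt.of_le (by exact_mod_cast le_top))
      ((contDiff_exp_neg_div z).contDiffAt.of_le (by exact_mod_cast le_top)), Finset.sum_mul]
    refine (norm_sum_le _ _).trans (Finset.sum_le_sum fun i _ => ?_)
    have h1 := iteratedDeriv_clm_comp ofRealCLM (χ k).contDiff i t
    have e1 : iteratedDeriv i (fun t => ((χ k t : ℝ) : ℂ)) t = (iteratedDeriv i (χ k) t : ℝ) := h1
    rw [e1, iteratedDeriv_exp_neg_div, norm_mul, norm_mul, norm_mul, norm_pow, norm_neg, norm_real,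
      ← mul_assoc, Real.norm_eq_abs]
    have := hM i k t
    rw [norm_natCast]
    gcongr
  refine tendsto_integral_of_dominated_convergence
    (fun t => (∑ i ∈ Finset.range (j + 1), j.choose i * M i * ‖z⁻¹‖ ^ (j - i)) *
      ‖g t * exp (-(t : ℂ) / z)‖) (fun k => ?_) (hint.norm.const_mul _) (fun k => ?_) ?_
  · refine ContinuousOn.aestronglyMeasurable (ContinuousOn.mul (Continuous.continuousOn ?_)
      (hg.mono Set.Ioi_subset_Ici_self)) measurableSet_Ioi
    exact (expTest (χ k) z).contDiff.continuous_iteratedDeriv j (by exact_mod_cast le_top)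
  · refine Eventually.of_forall fun t => ?_
    rw [norm_mul, norm_mul]
    refine (mul_le_mul_of_nonneg_right (hbound k t) (norm_nonneg _)).trans (le_of_eq ?_)
    ring
  · refine Eventually.of_forall fun t => tendsto_const_nhds.congr' ?_
    -- The radius |t| + 1 makes χₖ equal to 1 on a neighbourhood of t, as the derivatives require,
    -- and not only at t.
    filter_upwards [hχ.eventually_one (|t| + 1)] with k hk
    have heq : (expTest (χ k) z : ℝ → ℂ) =ᶠ[𝓝 t] fun t : ℝ => exp (-(t : ℂ) / z) := by
      have hn : {s : ℝ | |s| < |t| + 1} ∈ 𝓝 t :=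
        (isOpen_lt continuous_abs continuous_const).mem_nhds (by simp)
      filter_upwards [hn] with s hs
      rw [hfun]
      simp [hk s (le_of_lt hs)]
    rw [heq.iteratedDeriv_eq j, iteratedDeriv_exp_neg_div]
    ring

/-! ### Conjugation and the principal part -/

/-- The cut-off χ is real, so conjugating z conjugates the test function; pairing the conjugate
distribution with ψ gives the conjugate of T paired with ψ̄. -/
lemma pairing_principalPart (T : Distr) (χ : 𝓓((⊤ : Opens ℝ), ℝ)) (z : ℂ) :
    pairing (principalPart T) (expTest χ z) =
      1 / 2 * (pairing T (expTest χ z) + conj (pairing T (expTest χ (conj z)))) := by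
  have hexp : ∀ t : ℝ, exp (-(t : ℂ) / conj z) = conj (exp (-(t : ℂ) / z)) := fun t => by
    rw [← exp_conj]; simp
  have h1 : TestFunction.postcompCLM reCLM (expTest χ (conj z)) =
      TestFunction.postcompCLM reCLM (expTest χ z) := by
    ext t
    change ((χ t : ℂ) * exp (-(t : ℂ) / conj z)).re = ((χ t : ℂ) * exp (-(t : ℂ) / z)).re
    rw [hexp, re_ofReal_mul, re_ofReal_mul, conj_re]
  have h2 : TestFunction.postcompCLM imCLM (expTest χ (conj z)) =
      -TestFunction.postcompCLM imCLM (expTest χ z) := by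
    ext t
    change ((χ t : ℂ) * exp (-(t : ℂ) / conj z)).im = -((χ t : ℂ) * exp (-(t : ℂ) / z)).im
    rw [hexp, im_ofReal_mul, im_ofReal_mul, conj_im]
    ring
  have hpp : ∀ φ, principalPart T φ = 1 / 2 * (T φ + conj (T φ)) := fun φ => by
    change (1 / 2 : ℝ) • (T φ + conj (T φ)) = _
    rw [real_smul]; push_cast; ring
  rw [pairing, pairing, pairing, h1, h2, hpp, hpp]
  simp only [map_neg, map_add, map_mul, conj_I]
  ring

theorem HasLaplaceIntegral.principalPart {T : Distr} {z L L' : ℂ} (h : HasLaplaceIntegral T z L)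
    (h' : HasLaplaceIntegral T (conj z) L') :
    HasLaplaceIntegral (principalPart T) z (1 / 2 * (L + conj L')) := by
  intro χ hχ
  simp only [pairing_principalPart]
  exact ((h χ hχ).add ((continuous_conj.tendsto _).comp (h' χ hχ))).const_mul _

theorem HasLaplaceBorel.principalPart {T : Distr} {z w w' : ℂ} (h : HasLaplaceBorel T z w)
    (h' : HasLaplaceBorel T (conj z) w') :
    HasLaplaceBorel (principalPart T) z (1 / 2 * (w + conj w')) := by
  obtain ⟨L, hL, rfl⟩ := h
  obtain ⟨L', hL', rfl⟩ := h'
  refine ⟨_, hL.principalPart hL', ?_⟩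
  simp only [map_mul, map_inv₀, conj_conj]
  ring

theorem IsBoundaryValue.re {B : ℂ → ℂ} {T : Distr} (h : IsBoundaryValue B T) :
    IsBoundaryValue (fun t => ((B t).re : ℂ)) (principalPart T) := by
  intro φ
  obtain ⟨h1, h2⟩ := h φ
  have hpt : ∀ (ε t : ℝ), (((B (t + ε * I)).re : ℝ) : ℂ) * (φ t : ℂ) =
      (((B (t + ε * I) * (φ t : ℂ)).re : ℝ) : ℂ) := fun ε t => by
    rw [re_mul_ofReal]; push_cast; rfl
  simp only [hpt]
  refine ⟨?_, ?_⟩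
  · filter_upwards [h1] with ε hε
    exact hε.re.ofReal
  · have hpp : principalPart T φ = ((T φ).re : ℂ) := by
      change (1 / 2 : ℝ) • (T φ + conj (T φ)) = _
      rw [real_smul, add_conj]; push_cast; ring
    rw [hpp]
    have h3 : Continuous fun w : ℂ => ((w.re : ℝ) : ℂ) := by fun_prop
    refine ((h3.tendsto _).comp h2).congr' ?_
    filter_upwards [h1] with ε hε
    rw [Function.comp_apply, integral_complex_ofReal]
    congr 1
    exact (reCLM.integral_comp_comm hε).symm

/-! ### Boundary values -/

lemma add_mul_I_mem_closedQuadrant {t ε : ℝ} (ht : 0 ≤ t) (hε : 0 ≤ ε) :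
    (t + ε * I : ℂ) ∈ closedQuadrant := by
  simp [closedQuadrant, ht, hε]

lemma tendsto_integral_boundary {G : ℂ → ℂ} (hG : ContinuousOn G closedQuadrant) {ψ : ℝ → ℝ}
    (hψ : Continuous ψ) (hs : HasCompactSupport ψ) :
    (∀ ε : ℝ, 0 < ε → IntegrableOn (fun t : ℝ => G (t + ε * I) * (ψ t : ℂ)) (Set.Ioi 0)) ∧
    Tendsto (fun ε : ℝ => ∫ t in Set.Ioi (0 : ℝ), G (t + ε * I) * (ψ t : ℂ)) (𝓝[>] 0)
      (𝓝 (∫ t in Set.Ioi (0 : ℝ), (ψ t : ℂ) * G t)) := by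
  have hK : ∀ E : ℝ, ∃ C : ℝ, ∀ ε t : ℝ, 0 ≤ ε → ε ≤ E → 0 ≤ t →
      ‖G (t + ε * I) * (ψ t : ℂ)‖ ≤ C * ‖ψ t‖ := by
    intro E
    have hc : IsCompact (Set.Icc (0 : ℝ) E ×ˢ (tsupport ψ ∩ Set.Ici 0)) :=
      isCompact_Icc.prod (hs.isCompact.inter_right isClosed_Ici)
    obtain ⟨C, hC⟩ := hc.exists_bound_of_continuousOn
      (f := fun q : ℝ × ℝ => G (q.2 + q.1 * I))
      (hG.comp (by fun_prop) fun q hq => add_mul_I_mem_closedQuadrant hq.2.2 hq.1.1)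
    refine ⟨C, fun ε t h1 h2 ht => ?_⟩
    rw [norm_mul, norm_real]
    by_cases hts : t ∈ tsupport ψ
    · exact mul_le_mul_of_nonneg_right (hC (ε, t) ⟨⟨h1, h2⟩, hts, ht⟩) (norm_nonneg _)
    · simp [image_eq_zero_of_notMem_tsupport hts]
  have hmeas : ∀ ε : ℝ, 0 ≤ ε → AEStronglyMeasurable (fun t : ℝ => G (t + ε * I) * (ψ t : ℂ))
      (volume.restrict (Set.Ioi 0)) := fun ε hε => by
    refine ContinuousOn.aestronglyMeasurable ?_ measurableSet_Ioi
    exact (hG.comp (by fun_prop) fun t ht =>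
      add_mul_I_mem_closedQuadrant (le_of_lt ht) hε).mul (by fun_prop)
  have hψi : IntegrableOn (fun t => ‖ψ t‖) (Set.Ioi 0) :=
    (hψ.integrable_of_hasCompactSupport hs).norm.integrableOn
  constructor
  · intro ε hε
    obtain ⟨C, hC⟩ := hK ε
    refine Integrable.mono' (hψi.const_mul C) (hmeas ε hε.le) ?_
    filter_upwards [ae_restrict_mem measurableSet_Ioi] with t ht
    exact hC ε t hε.le le_rfl (le_of_lt ht)
  · obtain ⟨C, hC⟩ := hK 1
    refine tendsto_integral_filter_of_dominated_convergence (fun t => C * ‖ψ t‖) ?_ ?_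
      (hψi.const_mul C) ?_
    · filter_upwards [self_mem_nhdsWithin] with ε hε using hmeas ε (le_of_lt hε)
    · filter_upwards [Ioc_mem_nhdsGT (zero_lt_one' ℝ)] with ε hε
      filter_upwards [ae_restrict_mem measurableSet_Ioi] with t ht
      exact hC ε t hε.1.le hε.2 (le_of_lt ht)
    · filter_upwards [ae_restrict_mem measurableSet_Ioi] with t ht
      have ht0 : (0 : ℝ) ≤ t := le_of_lt ht
      have h1 : ContinuousOn (fun ε : ℝ => G (t + ε * I)) (Set.Ici 0) :=
        hG.comp (by fun_prop) fun ε hε => add_mul_I_mem_closedQuadrant ht0 hε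
      have h2 := (h1 0 Set.self_mem_Ici).mono Set.Ioi_subset_Ici_self
      have h3 := h2.tendsto.mul_const ((ψ t : ℝ) : ℂ)
      simpa [mul_comm] using h3

theorem isBoundaryValue_of_continuousOn {G : ℂ → ℂ} (hG : ContinuousOn G closedQuadrant) :
    IsBoundaryValue G (halfLineDistr (fun t => G t) 0) := by
  intro φ
  have hg : ContinuousOn (fun t : ℝ => G t) (Set.Ici 0) :=
    hG.comp (by fun_prop) fun t ht => by simpa using add_mul_I_mem_closedQuadrant ht le_rfl
  obtain ⟨h1, h2⟩ := tendsto_integral_boundary hG φ.continuous φ.hasCompactSupport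
  rw [halfLineDistr_apply hg]
  simp only [iteratedDeriv_zero]
  exact ⟨eventually_mem_nhdsWithin.mono h1, h2⟩

lemma continuousOn_primTwo_ofReal : ContinuousOn (fun t : ℝ => primTwo t) (Set.Ici 0) :=
  continuousOn_primTwo.comp (by fun_prop) fun t ht => by
    simpa using add_mul_I_mem_closedQuadrant ht le_rfl

/-- The distribution `B(t + i0)`. -/
noncomputable def borelDistr : Distr := halfLineDistr (fun t => primTwo t) 2

/-- Two integrations by parts on the line Im t = ε move the derivatives to φ. Continuity of
`primTwo` up to the half-line gives the limit of the integral. The boundary terms at t = 0 tend to 0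
since both primitives vanish at the origin, even when φ does not. -/
theorem isBoundaryValue_borelDistr : IsBoundaryValue borelB borelDistr := by
  intro φ
  have hφ : ContDiff ℝ ∞ φ := φ.contDiff
  have hφ1 : ContDiff ℝ ∞ (deriv φ) := (contDiff_infty_iff_deriv.1 hφ).2
  have hφ2 : ContDiff ℝ ∞ (deriv (deriv φ)) := (contDiff_infty_iff_deriv.1 hφ1).2
  have hs := φ.hasCompactSupport
  have hs1 : HasCompactSupport (deriv φ) := hs.deriv
  have hs2 : HasCompactSupport (deriv (deriv φ)) := hs1.deriv
  have hmem : ∀ ε t : ℝ, 0 < ε → (t + ε * I : ℂ) ∈ upperDomain := fun ε t hε =>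
    mem_upperDomain_of_im_pos (by simpa using hε)
  have hline : ∀ ε t : ℝ, HasDerivAt (fun t : ℝ => (t + ε * I : ℂ)) 1 t := fun ε t =>
    (hasDerivAt_id t).ofReal_comp.add_const _
  have hintB : ∀ ε : ℝ, 0 < ε →
      IntegrableOn (fun t : ℝ => borelB (t + ε * I) * (φ t : ℂ)) (Set.Ioi 0) := by
    intro ε hε
    refine (Continuous.integrable_of_hasCompactSupport ?_ ?_).integrableOn
    · refine Continuous.mul ?_ (continuous_ofReal.comp hφ.continuous)
      exact differentiableOn_borelB.continuousOn.comp_continuous (by fun_prop) fun t => hmem ε t hε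
    · exact (hs.comp_left (g := fun x : ℝ => (x : ℂ)) ofReal_zero).mul_left
  refine ⟨eventually_mem_nhdsWithin.mono hintB, ?_⟩
  obtain ⟨hintG, hlimG⟩ := tendsto_integral_boundary continuousOn_primTwo hφ2.continuous hs2
  have hval : borelDistr φ =
      ∫ t in Set.Ioi (0 : ℝ), ((deriv (deriv φ) t : ℝ) : ℂ) * primTwo t := by
    rw [borelDistr, halfLineDistr_apply continuousOn_primTwo_ofReal]
    simp only [iteratedDeriv_succ, iteratedDeriv_zero]
  have hparts : ∀ ε : ℝ, 0 < ε →
      ∫ t in Set.Ioi (0 : ℝ), borelB (t + ε * I) * (φ t : ℂ) =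
        (∫ t in Set.Ioi (0 : ℝ), primTwo (t + ε * I) * ((deriv (deriv φ) t : ℝ) : ℂ)) -
          (primOne (ε * I) * φ 0 - primTwo (ε * I) * (deriv φ 0 : ℝ)) := by
    intro ε hε
    have hd : ∀ t : ℝ, HasDerivAt (fun t : ℝ => primOne (t + ε * I) * (φ t : ℂ) -
        primTwo (t + ε * I) * ((deriv φ t : ℝ) : ℂ))
        (borelB (t + ε * I) * (φ t : ℂ) -
          primTwo (t + ε * I) * ((deriv (deriv φ) t : ℝ) : ℂ)) t := by
      intro t
      have d1 := HasDerivAt.comp (h₂ := primOne) t (hasDerivAt_primOne (hmem ε t hε)) (hline ε t)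
      have d2 := HasDerivAt.comp (h₂ := primTwo) t (hasDerivAt_primTwo (hmem ε t hε)) (hline ε t)
      have p1 := ((hφ.differentiable (by simp) t).hasDerivAt).ofReal_comp
      have p2 := ((hφ1.differentiable (by simp) t).hasDerivAt).ofReal_comp
      refine ((d1.mul p1).sub (d2.mul p2)).congr_deriv ?_
      simp only [Function.comp_apply]
      ring
    have hlim : Tendsto (fun t : ℝ => primOne (t + ε * I) * (φ t : ℂ) -
        primTwo (t + ε * I) * ((deriv φ t : ℝ) : ℂ)) atTop (𝓝 0) := by
      have hle : (atTop : Filter ℝ) ≤ coclosedCompact ℝ := by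
        rw [coclosedCompact_eq_cocompact]; exact atTop_le_cocompact
      have z1 := (hasCompactSupport_iff_eventuallyEq.1 hs).filter_mono hle
      have z2 := (hasCompactSupport_iff_eventuallyEq.1 hs1).filter_mono hle
      refine tendsto_const_nhds.congr' ?_
      filter_upwards [z1, z2] with t e1 e2
      simp [e1, e2]
    have hi := integral_Ioi_of_hasDerivAt_of_tendsto (a := (0 : ℝ))
      (hd 0).continuousAt.continuousWithinAt (fun t _ => hd t)
      ((hintB ε hε).sub (hintG ε hε)) hlim
    rw [integral_sub (hintB ε hε) (hintG ε hε)] at hi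
    simp only [ofReal_zero, zero_add] at hi
    linear_combination hi
  have hb : Tendsto (fun ε : ℝ => primOne (ε * I) * φ 0 - primTwo (ε * I) * (deriv φ 0 : ℝ))
      (𝓝[>] 0) (𝓝 0) := by
    have hl : Tendsto (fun ε : ℝ => (ε * I : ℂ)) (𝓝[>] 0) (𝓝 0) := by
      have : Continuous fun ε : ℝ => (ε * I : ℂ) := by fun_prop
      simpa using (this.tendsto 0).mono_left (nhdsWithin_le_nhds (s := Set.Ioi 0))
    have l1 := (hasDerivAt_primOne zero_mem_upperDomain).continuousAt.tendsto.comp hl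
    have l2 := (hasDerivAt_primTwo zero_mem_upperDomain).continuousAt.tendsto.comp hl
    simpa using (l1.mul_const ((φ 0 : ℝ) : ℂ)).sub (l2.mul_const ((deriv φ 0 : ℝ) : ℂ))
  rw [hval]
  have := hlimG.sub hb
  rw [sub_zero] at this
  refine this.congr' ?_
  filter_upwards [self_mem_nhdsWithin] with ε hε using (hparts ε hε).symm

/-! ### The third primitive of the Borel transform -/

/-- The third primitive of `borelB`, vanishing with its first two derivatives at the origin. -/
noncomputable def primThree (t : ℂ) : ℂ := t * ∫ u in (0 : ℝ)..1, primTwo (u * t)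

lemma ofReal_mul_mem_upperDomain {t : ℂ} (ht : t ∈ upperDomain) {u : ℝ} (hu : u ∈ Set.Icc 0 1) :
    (u : ℂ) * t ∈ upperDomain := by
  rcases hu.1.eq_or_lt with rfl | h0
  · simpa using zero_mem_upperDomain
  rcases ht with ht | ht
  · left
    rw [mem_ball_zero_iff] at ht ⊢
    rw [norm_mul, norm_real, Real.norm_of_nonneg hu.1]
    nlinarith [hu.2, norm_nonneg t]
  · right
    have : 0 < t.im := ht
    simp only [Set.mem_ofPred_eq, im_ofReal_mul]
    positivity

lemma ofReal_mul_mem_closedQuadrant {t : ℂ} (ht : t ∈ closedQuadrant) {u : ℝ} (hu : 0 ≤ u) :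
    (u : ℂ) * t ∈ closedQuadrant := by
  refine ⟨?_, ?_⟩
  · rw [re_ofReal_mul]; exact mul_nonneg hu ht.1
  · rw [im_ofReal_mul]; exact mul_nonneg hu ht.2

lemma continuousOn_primOne : ContinuousOn primOne upperDomain := fun _ ht =>
  (hasDerivAt_primOne ht).continuousAt.continuousWithinAt

theorem hasDerivAt_primThree {t : ℂ} (ht : t ∈ upperDomain) :
    HasDerivAt primThree (primTwo t) t := by
  have hc2 : ∀ s ∈ upperDomain, ContinuousOn (fun u : ℝ => primTwo (u * s)) (Set.Icc 0 1) :=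
    fun s hs => differentiableOn_primTwo.continuousOn.comp (by fun_prop)
      fun u hu => ofReal_mul_mem_upperDomain hs hu
  have hc1 : ContinuousOn (fun u : ℝ => u * primOne (u * t)) (Set.Icc 0 1) :=
    ContinuousOn.mul (by fun_prop) (continuousOn_primOne.comp (by fun_prop)
      fun u hu => ofReal_mul_mem_upperDomain ht hu)
  obtain ⟨δ, hδ, hball⟩ := Metric.nhds_basis_closedBall.mem_iff.1 (isOpen_upperDomain.mem_nhds ht)
  have hK : IsCompact (Set.Icc (0 : ℝ) 1 ×ˢ Metric.closedBall t δ) :=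
    isCompact_Icc.prod (isCompact_closedBall t δ)
  obtain ⟨M, hM⟩ := hK.exists_bound_of_continuousOn
    (f := fun q : ℝ × ℂ => (q.1 : ℂ) * primOne (q.1 * q.2))
    (ContinuousOn.mul (by fun_prop) (continuousOn_primOne.comp (by fun_prop)
      fun q hq => ofReal_mul_mem_upperDomain (hball hq.2) hq.1))
  have hsub : Set.uIoc (0 : ℝ) 1 ⊆ Set.Icc 0 1 := by
    rw [Set.uIoc_of_le zero_le_one]; exact Set.Ioc_subset_Icc_self
  have hI : HasDerivAt (fun s => ∫ u in (0 : ℝ)..1, primTwo (u * s))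
      (∫ u in (0 : ℝ)..1, u * primOne (u * t)) t := by
    refine (intervalIntegral.hasDerivAt_integral_of_dominated_loc_of_deriv_le
      (F := fun s u => primTwo (u * s)) (F' := fun s (u : ℝ) => u * primOne (u * s))
      (bound := fun _ => M) (Metric.closedBall_mem_nhds t hδ) ?_ ?_ ?_ ?_ (by simp) ?_).2
    · filter_upwards [isOpen_upperDomain.mem_nhds ht] with s hs
      exact ((hc2 s hs).mono hsub).aestronglyMeasurable measurableSet_uIoc
    · exact ContinuousOn.intervalIntegrable_of_Icc zero_le_one (hc2 t ht)
    · exact (hc1.mono hsub).aestronglyMeasurable measurableSet_uIoc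
    · exact Eventually.of_forall fun u hu s hs => hM (u, s) ⟨hsub hu, hs⟩
    · refine Eventually.of_forall fun u hu s hs => ?_
      have h := HasDerivAt.comp (h₂ := primTwo) s
        (hasDerivAt_primTwo (ofReal_mul_mem_upperDomain (hball hs) (hsub hu)))
        ((hasDerivAt_id s).const_mul (u : ℂ))
      refine h.congr_deriv ?_
      ring
  refine ((hasDerivAt_id t).mul hI).congr_deriv ?_
  -- The product rule gives an integrand that is the total derivative in u of u · primTwo(ut); its
  -- integral over [0, 1] is primTwo(t).
  have hd : ∀ u ∈ Set.uIcc (0 : ℝ) 1, HasDerivAt (fun u : ℝ => (u : ℂ) * primTwo (u * t))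
      (primTwo (u * t) + t * (u * primOne (u * t))) u := by
    intro u hu
    rw [Set.uIcc_of_le zero_le_one] at hu
    have h1 : HasDerivAt (fun u : ℝ => (u : ℂ) * t) t u := by
      simpa using (hasDerivAt_id u).ofReal_comp.mul_const t
    have h2 := HasDerivAt.comp (h₂ := primTwo) u
      (hasDerivAt_primTwo (ofReal_mul_mem_upperDomain ht hu)) h1
    refine ((hasDerivAt_id u).ofReal_comp.mul h2).congr_deriv ?_
    simp only [Function.comp_apply, id, ofReal_one]
    ring
  have i1 : IntervalIntegrable (fun u : ℝ => primTwo (u * t)) volume 0 1 :=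
    ContinuousOn.intervalIntegrable_of_Icc zero_le_one (hc2 t ht)
  have i2 : IntervalIntegrable (fun u : ℝ => t * (u * primOne (u * t))) volume 0 1 :=
    (ContinuousOn.intervalIntegrable_of_Icc zero_le_one hc1).const_mul t
  have h := intervalIntegral.integral_eq_sub_of_hasDerivAt hd (i1.add i2)
  rw [intervalIntegral.integral_add i1 i2, intervalIntegral.integral_const_mul] at h
  simpa using h

theorem continuousOn_primThree : ContinuousOn primThree closedQuadrant := by
  refine continuousOn_id.mul fun t ht => ?_
  obtain ⟨C, hC, hb⟩ := exists_norm_primTwo_le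
  have hsub : Set.uIoc (0 : ℝ) 1 ⊆ Set.Icc 0 1 := by
    rw [Set.uIoc_of_le zero_le_one]; exact Set.Ioc_subset_Icc_self
  refine intervalIntegral.continuousWithinAt_of_dominated_interval
    (bound := fun _ => C * ((‖t‖ + 1) + (‖t‖ + 1) ^ 2)) ?_ ?_ (by simp) ?_
  · filter_upwards [self_mem_nhdsWithin] with s hs
    refine ContinuousOn.aestronglyMeasurable ?_ measurableSet_uIoc
    exact continuousOn_primTwo.comp (by fun_prop) fun u hu =>
      ofReal_mul_mem_closedQuadrant hs (hsub hu).1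
  · filter_upwards [mem_nhdsWithin_of_mem_nhds (Metric.ball_mem_nhds t one_pos)] with s hs
    refine Eventually.of_forall fun u hu => (hb _).trans ?_
    have hs1 : ‖s‖ ≤ ‖t‖ + 1 := by
      have := norm_le_insert' s t
      rw [mem_ball_iff_norm] at hs
      linarith
    have hn : ‖(u : ℂ) * s‖ ≤ ‖t‖ + 1 := by
      rw [norm_mul, norm_real, Real.norm_of_nonneg (hsub hu).1]
      nlinarith [(hsub hu).2, norm_nonneg s, (hsub hu).1]
    gcongr
  · refine Eventually.of_forall fun u hu => ?_
    exact (continuousOn_primTwo _ (ofReal_mul_mem_closedQuadrant ht (hsub hu).1)).comp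
      (f := fun s : ℂ => (u : ℂ) * s) (by fun_prop)
      fun s hs => ofReal_mul_mem_closedQuadrant hs (hsub hu).1

lemma exists_norm_primThree_le :
    ∃ C : ℝ, 0 < C ∧ ∀ t, ‖primThree t‖ ≤ C * (‖t‖ ^ 2 + ‖t‖ ^ 3) := by
  obtain ⟨C, hC, hb⟩ := exists_norm_primTwo_le
  refine ⟨C, hC, fun t => ?_⟩
  have h : ‖∫ u in (0 : ℝ)..1, primTwo (u * t)‖ ≤ C * (‖t‖ + ‖t‖ ^ 2) * |1 - 0| := by
    refine intervalIntegral.norm_integral_le_of_norm_le_const fun u hu => (hb _).trans ?_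
    rw [Set.uIoc_of_le zero_le_one] at hu
    have hn : ‖(u : ℂ) * t‖ ≤ ‖t‖ := by
      rw [norm_mul, norm_real, Real.norm_of_nonneg hu.1.le]
      nlinarith [hu.2, norm_nonneg t]
    gcongr
  rw [primThree, norm_mul]
  refine (mul_le_mul_of_nonneg_left h (norm_nonneg t)).trans (le_of_eq ?_)
  simp
  ring

lemma continuousOn_primThree_ofReal : ContinuousOn (fun t : ℝ => primThree t) (Set.Ici 0) :=
  continuousOn_primThree.comp (by fun_prop) fun t ht => by
    simpa using add_mul_I_mem_closedQuadrant ht le_rfl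

/-- The positive axis beyond 1/2 is outside `upperDomain`, so the complex derivative is not at hand.
On the axis `primThree` is an ordinary integral of a continuous function, and the real fundamental
theorem of calculus applies. -/
lemma hasDerivAt_primThree_ofReal {x : ℝ} (hx : 0 < x) :
    HasDerivAt (fun t : ℝ => primThree t) (primTwo x) x := by
  have hfun : (fun t : ℝ => primThree t) = fun t : ℝ => ∫ s in (0 : ℝ)..t, primTwo s := by
    ext t
    have := intervalIntegral.smul_integral_comp_mul_right (a := 0) (b := 1)
      (fun s : ℝ => primTwo s) t
    rw [zero_mul, one_mul] at this
    rw [← this, primThree, real_smul]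
    push_cast
    rfl
  rw [hfun]
  have hc := continuousOn_primTwo_ofReal
  refine intervalIntegral.integral_hasDerivAt_right ?_ ?_ ?_
  · exact ContinuousOn.intervalIntegrable_of_Icc hx.le (hc.mono Set.Icc_subset_Ici_self)
  · exact ⟨Set.Ioi 0, Ioi_mem_nhds hx,
      (hc.mono Set.Ioi_subset_Ici_self).aestronglyMeasurable measurableSet_Ioi⟩
  · exact hc.continuousAt (Ici_mem_nhds hx)

lemma neg_div_eq_neg_mul_inv (t : ℝ) (z : ℂ) : -(t : ℂ) / z = -(t * z⁻¹) := by
  rw [neg_div, div_eq_mul_inv]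

lemma inv_re_pos {z : ℂ} (hz : 0 < z.re) : 0 < (z⁻¹).re := by
  have h0 : z ≠ 0 := by rintro rfl; simp at hz
  rw [inv_re]
  exact div_pos hz (normSq_pos.2 h0)

lemma integrableOn_primTwo_mul_exp {z : ℂ} (hz : 0 < z.re) :
    IntegrableOn (fun t : ℝ => primTwo t * exp (-(t : ℂ) / z)) (Set.Ioi 0) := by
  obtain ⟨C, -, hb⟩ := exists_norm_primTwo_le
  simp only [neg_div_eq_neg_mul_inv]
  refine integrableOn_mul_exp_neg (C := C)
    (continuousOn_primTwo_ofReal.mono Set.Ioi_subset_Ici_self) (fun r hr => ?_) (inv_re_pos hz)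
  have := hb r
  rwa [norm_real, Real.norm_of_nonneg hr.le] at this

lemma norm_exp_neg_div (t : ℝ) (z : ℂ) :
    ‖exp (-(t : ℂ) / z)‖ = Real.exp (-((z⁻¹).re * t)) := by
  rw [neg_div_eq_neg_mul_inv, norm_exp, neg_re, re_ofReal_mul, mul_comm]

lemma norm_primThree_mul_exp_le : ∃ C : ℝ, ∀ (z : ℂ) (t : ℝ), 0 < t →
    ‖primThree t * exp (-(t : ℂ) / z)‖ ≤ C * (t ^ 2 * Real.exp (-((z⁻¹).re * t)) +
      t ^ 3 * Real.exp (-((z⁻¹).re * t))) := by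
  obtain ⟨C, -, hb⟩ := exists_norm_primThree_le
  refine ⟨C, fun z t ht => ?_⟩
  have := hb t
  rw [norm_real, Real.norm_of_nonneg ht.le] at this
  rw [norm_mul, norm_exp_neg_div]
  refine (mul_le_mul_of_nonneg_right this (Real.exp_pos _).le).trans (le_of_eq ?_)
  ring

lemma integrableOn_primThree_mul_exp {z : ℂ} (hz : 0 < z.re) :
    IntegrableOn (fun t : ℝ => primThree t * exp (-(t : ℂ) / z)) (Set.Ioi 0) := by
  obtain ⟨C, hb⟩ := norm_primThree_mul_exp_le
  refine Integrable.mono' (((integrableOn_pow_mul_exp_neg 2 (inv_re_pos hz)).add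
    (integrableOn_pow_mul_exp_neg 3 (inv_re_pos hz))).const_mul C) ?_ ?_
  · exact ((continuousOn_primThree_ofReal.mono Set.Ioi_subset_Ici_self).mul
      (contDiff_exp_neg_div z).continuous.continuousOn).aestronglyMeasurable measurableSet_Ioi
  · filter_upwards [ae_restrict_mem measurableSet_Ioi] with t ht using hb z t ht

theorem integral_primThree_mul_exp {z : ℂ} (hz : 0 < z.re) :
    ∫ t in Set.Ioi (0 : ℝ), primThree t * exp (-(t : ℂ) / z) = z * laplaceTwo z := by
  have h0 : z ≠ 0 := by rintro rfl; simp at hz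
  have i2 := (integrableOn_primTwo_mul_exp hz).const_mul z
  have i3 := integrableOn_primThree_mul_exp hz
  rw [laplaceTwo, ← integral_const_mul, ← sub_eq_zero, ← integral_sub i3 i2]
  have hde : ∀ t : ℝ, HasDerivAt (fun t : ℝ => exp (-(t : ℂ) / z))
      (exp (-(t : ℂ) / z) * (-1 / z)) t := fun t => by
    simpa using (((hasDerivAt_id t).ofReal_comp.neg).div_const z).cexp
  have hd : ∀ t ∈ Set.Ioi (0 : ℝ), HasDerivAt
      (fun t : ℝ => -z * (primThree t * exp (-(t : ℂ) / z)))
      (primThree t * exp (-(t : ℂ) / z) - z * (primTwo t * exp (-(t : ℂ) / z))) t := by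
    intro t ht
    refine (((hasDerivAt_primThree_ofReal ht).mul (hde t)).const_mul (-z)).congr_deriv ?_
    field_simp
    ring
  have hlim : Tendsto (fun t : ℝ => -z * (primThree t * exp (-(t : ℂ) / z))) atTop (𝓝 0) := by
    obtain ⟨C, hb⟩ := norm_primThree_mul_exp_le
    have hl := (((tendsto_pow_mul_exp_neg 2 (inv_re_pos hz)).add
      (tendsto_pow_mul_exp_neg 3 (inv_re_pos hz))).const_mul C)
    simp only [add_zero, mul_zero] at hl
    have : Tendsto (fun t : ℝ => primThree t * exp (-(t : ℂ) / z)) atTop (𝓝 0) := by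
      refine squeeze_zero_norm' ?_ hl
      filter_upwards [eventually_gt_atTop 0] with t ht using hb z t ht
    simpa using this.const_mul (-z)
  have hcont : ContinuousWithinAt (fun t : ℝ => -z * (primThree t * exp (-(t : ℂ) / z)))
      (Set.Ici 0) 0 :=
    ContinuousWithinAt.mul continuousWithinAt_const
      ((continuousOn_primThree_ofReal 0 Set.self_mem_Ici).mul
        (contDiff_exp_neg_div z).continuous.continuousWithinAt)
  rw [integral_Ioi_of_hasDerivAt_of_tendsto hcont hd (i3.sub i2) hlim]
  simp [primThree]

/-! ### Taylor series of the third primitive -/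

lemma iteratedDeriv_borelB (n : ℕ) : iteratedDeriv n borelB 0 = seriesShifted n := by
  have hd : AnalyticAt ℂ borelB 0 :=
    differentiableOn_borelB.analyticAt (isOpen_upperDomain.mem_nhds zero_mem_upperDomain)
  have h1 := hd.hasFPowerSeriesAt
  have h2 : HasFPowerSeriesAt borelB
      (FormalMultilinearSeries.ofScalars ℂ fun n => seriesShifted n / (n.factorial : ℂ)) 0 := by
    rw [hasFPowerSeriesAt_iff]
    filter_upwards [Metric.ball_mem_nhds (0 : ℂ) (by norm_num : (0 : ℝ) < 1 / 2)] with t ht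
    have := hasSum_borelB ht
    simp only [FormalMultilinearSeries.coeff_ofScalars, zero_add, smul_eq_mul]
    simpa only [mul_comm] using this
  have h3 := congrArg (fun p => p.coeff n) (h1.eq_formalMultilinearSeries h2)
  simp only [FormalMultilinearSeries.coeff_ofScalars] at h3
  have hf : (n.factorial : ℂ) ≠ 0 := by exact_mod_cast n.factorial_ne_zero
  exact (div_left_inj' hf).1 h3

/-- The n-th derivative at 0 of a Borel transform is the n-th coefficient of the series. Three
primitives vanishing at 0 therefore shift the coefficients by three places and put zeros in the
first three. -/
lemma iteratedDeriv_primThree (n : ℕ) : iteratedDeriv n primThree 0 = seriesFull n := by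
  have hn := isOpen_upperDomain.mem_nhds zero_mem_upperDomain
  have e3 : deriv primThree =ᶠ[𝓝 0] primTwo := by
    filter_upwards [hn] with t ht using (hasDerivAt_primThree ht).deriv
  have e1 : deriv primOne =ᶠ[𝓝 0] borelB := by
    filter_upwards [hn] with t ht using (hasDerivAt_primOne ht).deriv
  have s3 : ∀ m, iteratedDeriv (m + 1) primThree 0 = iteratedDeriv m primTwo 0 := fun m => by
    rw [iteratedDeriv_succ', e3.iteratedDeriv_eq m]
  have s2 : ∀ m, iteratedDeriv (m + 1) primTwo 0 = iteratedDeriv m primOne 0 := fun m => by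
    rw [iteratedDeriv_succ']; rfl
  have s1 : ∀ m, iteratedDeriv (m + 1) primOne 0 = iteratedDeriv m borelB 0 := fun m => by
    rw [iteratedDeriv_succ', e1.iteratedDeriv_eq m]
  match n with
  | 0 => simp [primThree, seriesFull]
  | 1 => simp [s3, seriesFull]
  | 2 => simp [s3, s2, seriesFull]
  | m + 3 =>
    rw [s3, s2, s1, iteratedDeriv_borelB, seriesFull, seriesShifted]
    -- m is odd exactly when m + 3 is even and at least 4; the case m + 3 = 3 is excluded by parity.
    refine if_congr ?_ rfl rfl
    constructor
    · rintro ⟨k, rfl⟩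
      exact ⟨⟨k + 2, by ring⟩, by omega⟩
    · rintro ⟨⟨k, hk⟩, -⟩
      exact ⟨k - 2, by omega⟩

theorem isBorelContinuation_primThree : IsBorelContinuation seriesFull primThree := by
  have hd : DifferentiableOn ℂ primThree upperDomain := fun t ht =>
    (hasDerivAt_primThree ht).differentiableAt.differentiableWithinAt
  refine ⟨1 / 2, by norm_num, Set.univ, isOpen_univ, fun _ _ => trivial, fun t ht => ?_, by
    simpa [upperDomain] using hd⟩
  have h := Complex.hasSum_taylorSeries_on_ball (hd.mono Set.subset_union_left) ht
  simp only [iteratedDeriv_primThree, sub_zero, smul_eq_mul] at h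
  have hterm : ∀ n : ℕ, seriesFull n / (n.factorial : ℂ) * t ^ n =
      (n.factorial : ℂ)⁻¹ * (t ^ n * seriesFull n) := fun n => by ring
  simpa only [hterm] using h

/-! ### Analyticity -/

/-- Differentiation under the integral is done in κ = 1/β, on the half-plane Re κ > Re(β⁻¹)/2, where
one exponential dominates; composing with inversion gives the claim. -/
theorem differentiableAt_laplaceTwo {β : ℂ} (hβ : 0 < β.re) : DifferentiableAt ℂ laplaceTwo β := by
  have h0 : β ≠ 0 := by rintro rfl; simp at hβ
  have hκ := inv_re_pos hβ
  obtain ⟨C, hC, hb⟩ := exists_norm_primTwo_le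
  set c := (β⁻¹).re / 2 with hc
  have hc0 : 0 < c := by positivity
  have hs : {κ : ℂ | c < κ.re} ∈ 𝓝 β⁻¹ :=
    (isOpen_lt continuous_const continuous_re).mem_nhds (by
      simp only [Set.mem_ofPred_eq, hc]; linarith)
  have hcont : ContinuousOn (fun t : ℝ => primTwo t) (Set.Ioi 0) :=
    continuousOn_primTwo_ofReal.mono Set.Ioi_subset_Ici_self
  have hmain : HasDerivAt (fun κ : ℂ => ∫ t in Set.Ioi (0 : ℝ), primTwo t * exp (-(t * κ)))
      (∫ t in Set.Ioi (0 : ℝ), primTwo t * (exp (-(t * β⁻¹)) * -t)) β⁻¹ := by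
    refine (hasDerivAt_integral_of_dominated_loc_of_deriv_le hs
      (F := fun κ (t : ℝ) => primTwo t * exp (-(t * κ)))
      (F' := fun κ (t : ℝ) => primTwo t * (exp (-(t * κ)) * -t))
      (bound := fun t => C * (t ^ 2 * Real.exp (-(c * t)) + t ^ 3 * Real.exp (-(c * t))))
      ?_ ?_ ?_ ?_ ?_ ?_).2
    · exact Eventually.of_forall fun κ =>
        (hcont.mul (by fun_prop)).aestronglyMeasurable measurableSet_Ioi
    · have := integrableOn_primTwo_mul_exp hβ
      simp only [neg_div_eq_neg_mul_inv] at this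
      exact this
    · exact (hcont.mul (by fun_prop)).aestronglyMeasurable measurableSet_Ioi
    · filter_upwards [ae_restrict_mem measurableSet_Ioi] with t ht κ hκ
      have ht0 : 0 < t := ht
      have hκc : c < κ.re := hκ
      have h1 := hb t
      rw [norm_real, Real.norm_of_nonneg ht0.le] at h1
      rw [norm_mul, norm_mul, norm_neg, norm_real, Real.norm_of_nonneg ht0.le, norm_exp, neg_re,
        re_ofReal_mul]
      have h2 : Real.exp (-(t * κ.re)) ≤ Real.exp (-(c * t)) := by
        rw [Real.exp_le_exp]; nlinarith
      calc _ ≤ C * (t + t ^ 2) * (Real.exp (-(c * t)) * t) := by gcongr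
        _ = _ := by ring
    · exact ((integrableOn_pow_mul_exp_neg 2 hc0).add
        (integrableOn_pow_mul_exp_neg 3 hc0)).const_mul C
    · refine Eventually.of_forall fun t κ _ => ?_
      have h : HasDerivAt (fun κ : ℂ => -((t : ℂ) * κ)) (-(t : ℂ)) κ := by
        simpa using ((hasDerivAt_id κ).const_mul (t : ℂ)).fun_neg
      exact (h.cexp).const_mul _
  have h := hmain.differentiableAt.comp (f := fun β : ℂ => β⁻¹) β (differentiableAt_inv h0)
  refine h.congr_of_eventuallyEq (Eventually.of_forall fun z => ?_)
  simp only [laplaceTwo, neg_div_eq_neg_mul_inv, Function.comp_apply]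

theorem differentiableOn_upperSum :
    DifferentiableOn ℂ (fun β => (β ^ 3)⁻¹ * Phi β) {β | 0 < β.re} := by
  have h : DifferentiableOn ℂ (fun β => (β ^ 3)⁻¹ * laplaceTwo β) {β | 0 < β.re} := by
    intro β hβ
    have hβ' : 0 < β.re := hβ
    have h0 : β ^ 3 ≠ 0 := pow_ne_zero 3 (by rintro rfl; simp at hβ')
    have h1 : DifferentiableAt ℂ (fun β : ℂ => (β ^ 3)⁻¹) β := (differentiableAt_pow 3).fun_inv h0
    exact (h1.mul (differentiableAt_laplaceTwo hβ')).differentiableWithinAt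
  exact h.congr fun β hβ => by rw [Phi_eq_laplaceTwo hβ]

/-! ### Laplace-Borel sums -/

lemma re_pos_of_mem_borelDisk {R : ℝ} (hR : 0 < R) {z : ℂ} (hz : z ∈ borelDisk R) : 0 < z.re := by
  have h : R⁻¹ < (z⁻¹).re := hz
  have h1 : 0 < (z⁻¹).re := (inv_pos.2 hR).trans h
  simpa using inv_re_pos h1

theorem hasLaplaceBorel_borelDistr {β : ℂ} (hβ : 0 < β.re) :
    HasLaplaceBorel borelDistr β ((β ^ 3)⁻¹ * Phi β) := by
  refine ⟨_, hasLaplaceIntegral_halfLineDistr continuousOn_primTwo_ofReal 2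
    (integrableOn_primTwo_mul_exp hβ), ?_⟩
  rw [Phi_eq_laplaceTwo hβ, laplaceTwo]
  ring

/-- The boundary value of `primThree`. -/
noncomputable def primThreeDistr : Distr := halfLineDistr (fun t => primThree t) 0

theorem hasLaplaceBorel_primThreeDistr {β : ℂ} (hβ : 0 < β.re) :
    HasLaplaceBorel primThreeDistr β (Phi β) := by
  have h0 : β ≠ 0 := by rintro rfl; simp at hβ
  refine ⟨_, hasLaplaceIntegral_halfLineDistr continuousOn_primThree_ofReal 0
    (integrableOn_primThree_mul_exp hβ), ?_⟩
  rw [Phi_eq_laplaceTwo hβ, integral_primThree_mul_exp hβ, pow_zero, one_mul,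
    inv_mul_cancel_left₀ h0]

end VacPol

/-! ### Assembly of the main theorem. -/

theorem mainTheorem3 :
    -- the improper integral defining `Φ(β) = S(β²)` converges for `Re β > 0`
    (∀ β : ℂ, 0 < β.re →
      Tendsto (VacPol.actionPartial (β ^ 2)) atTop (𝓝 (VacPol.Phi β))) ∧
    -- the rotated representation of `Φ`
    (∀ β : ℂ, 0 < β.arg → β.arg < Real.pi / 2 →
      IntegrableOn (VacPol.rotatedIntegrand β) (Set.Ioi 0) ∧
      VacPol.Phi β =
        1 / (8 * (Real.pi : ℂ) ^ 2) * ∫ t in Set.Ioi (0 : ℝ), VacPol.rotatedIntegrand β t) ∧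
    -- `B` is the Borel transform of `∑ aₙ β^{2n-3}`
    VacPol.IsBorelContinuation VacPol.seriesShifted VacPol.borelB ∧
    -- `T = B(t + i0)` exists, and `PP(B(t))` is the boundary value of `Re B`
    ∃ T : VacPol.Distr, VacPol.IsBoundaryValue VacPol.borelB T ∧
      VacPol.IsBoundaryValue (fun t => ((VacPol.borelB t).re : ℂ)) (VacPol.principalPart T) ∧
      ∃ F f : ℂ → ℂ,
        -- the Laplace-Borel integral of `B(t + i0)` is `F`, the one of `PP(B(t))` is `f`
        (∀ β : ℂ, 0 < β.re → VacPol.HasLaplaceBorel T β (F β)) ∧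
        DifferentiableOn ℂ F {β | 0 < β.re} ∧
        (∀ β : ℂ, 0 < β.re → F β = (β ^ 3)⁻¹ * VacPol.Phi β) ∧
        (∀ β : ℂ, 0 < β.re → VacPol.HasLaplaceBorel (VacPol.principalPart T) β (f β)) ∧
        (∀ β : ℂ, 0 < β.re →
          f β = 1 / 2 * ((β ^ 3)⁻¹ * VacPol.Phi β +
            conj (((conj β) ^ 3)⁻¹ * VacPol.Phi (conj β)))) ∧
        -- distributional Borel summability of `∑ aₙ β^{2n-3}`
        (∀ R : ℝ, 0 < R →
          VacPol.IsUpperSum VacPol.seriesShifted (fun β => (β ^ 3)⁻¹ * VacPol.Phi β) R ∧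
          VacPol.IsDistributionalBorelSum VacPol.seriesShifted f R) ∧
        -- distributional Borel summability of `∑ aₙ β^{2n}`
        (∀ R : ℝ, 0 < R →
          VacPol.IsUpperSum VacPol.seriesFull VacPol.Phi R ∧
          VacPol.IsDistributionalBorelSum VacPol.seriesFull (fun β => β ^ 3 * f β) R) ∧
        (∀ β : ℂ, 0 < β.re →
          β ^ 3 * f β = 1 / 2 * (VacPol.Phi β + conj (VacPol.Phi (conj β)))) := by
  have hconj : ∀ β : ℂ, 0 < β.re → 0 < (conj β).re := fun β hβ => by rwa [conj_re]
  have hf : ∀ β : ℂ, 0 < β.re → VacPol.HasLaplaceBorel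
      (VacPol.principalPart VacPol.borelDistr) β (1 / 2 * ((β ^ 3)⁻¹ * VacPol.Phi β +
        conj (((conj β) ^ 3)⁻¹ * VacPol.Phi (conj β)))) := fun β hβ =>
    (VacPol.hasLaplaceBorel_borelDistr hβ).principalPart
      (VacPol.hasLaplaceBorel_borelDistr (hconj β hβ))
  have hcube : ∀ β : ℂ, 0 < β.re → β ^ 3 * (1 / 2 * ((β ^ 3)⁻¹ * VacPol.Phi β +
      conj (((conj β) ^ 3)⁻¹ * VacPol.Phi (conj β)))) =
        1 / 2 * (VacPol.Phi β + conj (VacPol.Phi (conj β))) := fun β hβ => by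
    have h0 : β ≠ 0 := by rintro rfl; simp at hβ
    simp only [map_mul, map_inv₀, map_pow, conj_conj]
    field_simp
  have hbv3 : VacPol.IsBoundaryValue VacPol.primThree VacPol.primThreeDistr :=
    VacPol.isBoundaryValue_of_continuousOn VacPol.continuousOn_primThree
  refine ⟨fun β hβ => ?_, fun β => VacPol.rotated_representation,
    VacPol.isBorelContinuation_borelB, VacPol.borelDistr, VacPol.isBoundaryValue_borelDistr,
    VacPol.isBoundaryValue_borelDistr.re, fun β => (β ^ 3)⁻¹ * VacPol.Phi β,
    fun β => 1 / 2 * ((β ^ 3)⁻¹ * VacPol.Phi β +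
      conj (((conj β) ^ 3)⁻¹ * VacPol.Phi (conj β))),
    fun β => VacPol.hasLaplaceBorel_borelDistr, fun β hβ => ?_, fun β _ => rfl, hf,
    fun β _ => rfl, fun R hR => ⟨?_, ?_⟩, fun R hR => ⟨?_, ?_⟩, hcube⟩
  · rw [VacPol.Phi_eq_laplaceTwo hβ]
    exact VacPol.tendsto_actionPartial hβ
  · exact VacPol.differentiableOn_upperSum β hβ
  · exact ⟨hR, VacPol.borelB, VacPol.borelDistr, VacPol.isBorelContinuation_borelB,
      VacPol.isBoundaryValue_borelDistr, fun z hz =>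
        VacPol.hasLaplaceBorel_borelDistr (VacPol.re_pos_of_mem_borelDisk hR hz)⟩
  · exact ⟨hR, VacPol.borelB, VacPol.borelDistr, VacPol.isBorelContinuation_borelB,
      VacPol.isBoundaryValue_borelDistr, fun z hz => hf z (VacPol.re_pos_of_mem_borelDisk hR hz)⟩
  · exact ⟨hR, VacPol.primThree, VacPol.primThreeDistr, VacPol.isBorelContinuation_primThree,
      hbv3, fun z hz =>
        VacPol.hasLaplaceBorel_primThreeDistr (VacPol.re_pos_of_mem_borelDisk hR hz)⟩
  -- By `hcube` the function β³f is half the sum of Φ and its reflection, hence the principal-part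
  -- integral of `primThreeDistr`.
  · refine ⟨hR, VacPol.primThree, VacPol.primThreeDistr, VacPol.isBorelContinuation_primThree,
      hbv3, fun z hz => ?_⟩
    have hz' := VacPol.re_pos_of_mem_borelDisk hR hz
    simp only [hcube z hz']
    exact (VacPol.hasLaplaceBorel_primThreeDistr hz').principalPart
      (VacPol.hasLaplaceBorel_primThreeDistr (hconj z hz'))
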